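/- **Setting.** Let $M_k$ be the space of complex $k\times k$ matrices with the inner product $\langle C,D\rangle=\operatorname{tr}(CD^*)$, and identify $M_k\otimes M_m$ with $M_{km}$ through the Kronecker product. * A *Hermitian Schmidt decomposition* of $A\in M_k\otimes M_m$ is a finite (possibly empty) sum $A=\sum_{i=1}^n\lambda_i\,\gamma_i\otimes\delta_i$ with all $\lambda_i>0$, where $\gamma_1,\dots,\gamma_n\in M_k$ are Hermitian and orthonormal, and so are $\delta_1,\dots,\delta_n\in M_m$. * A positive semidefinite Hermitian $A\in M_k\otimes M_k$ is *SPC* if it has a Hermitian Schmidt decomposition $\sum_i\lambda_i\,\gamma_i\otimes\gamma_i$. A positive semidefinite Hermitian $A\in M_k\otimes M_m$ is *PPT* if its transpose in the first tensor factor is also positive semidefinite Hermitian. * $A\in M_k\otimes M_m$ is *separable* if $A=\sum_{i=1}^n C_i\otimes D_i$ with all $C_i\in M_k$, $D_i\in M_m$ positive semidefinite Hermitian. Its *tensor rank* is the least number of nonzero tensors $C\otimes D$ ($C\in M_k$, $D\in M_m$) whose sum is $A$. * A positive semidefinite Hermitian $A\in M_k\otimes M_m$ is *weak irreducible* if for all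 Hermitian projections $V_1,V_2\in M_k$, $W_1,W_2\in M_m$ with $V_1V_2=0$, $W_1W_2=0$, $V_1+V_2=\mathrm{Id}$, $W_1+W_2=\mathrm{Id}$: whenever $A=\sum_{i=1}^2(V_i\otimes W_i)A(V_i\otimes W_i)$, then $(V_1\otimes W_1)A(V_1\otimes W_1)=0$ or $(V_2\otimes W_2)A(V_2\otimes W_2)=0$. * A *split decomposition* of a PPT matrix $A$ is obtained as follows. Take a Hermitian Schmidt decomposition $A=\sum_{i=1}^n\lambda_i\,\gamma_i\otimes\delta_i$ with $\lambda_1=\dots=\lambda_s>\lambda_{s+1}\ge\dots\ge\lambda_n$, $s\ge1$, and a Hermitian Schmidt decomposition $\sum_{i=1}^s\gamma_i\otimes\delta_i=\sum_{i=1}^s\gamma_i'\otimes\delta_i'$ (all coefficients $1$) with all $\gamma_i',\delta_i'$ positive semidefinite. For $i\le s$ let $V_i$, $W_i$ be the Hermitian projections onto the images of $\gamma_i'$, $\delta_i'$, and let $V_{s+1}$, $W_{s+1}$ be the Hermitian projections onto the orthogonal complements of the sums of the images of the $\gamma_i'$, respectively of the $\delta_i'$. Its *terms* are $A_i=(V_i\otimes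 W_i)A(V_i\otimes W_i)$, $1\le i\le s+1$. A split decomposition of an SPC matrix is defined in the same way, with $\delta_i=\gamma_i$, $\delta_i'=\gamma_i'$ and $W_i=V_i$. * A *split reduction* of $A$ is a finite list of matrices obtained recursively: if $A$ is weak irreducible, the list is $[A]$; if it is not, the list is the concatenation of split reductions of the terms of a split decomposition of $A$. For SPC (PPT) matrices, the SPC (PPT) form of the split decomposition is used throughout. **Statement.** Let $A$ be an SPC matrix in $M_k\otimes M_k$ (respectively, a PPT matrix in $M_k\otimes M_m$). 1. If $A\neq0$, then $A$ has a split decomposition. For every split decomposition of $A$, with terms $A_1,\dots,A_{s+1}$: $A=\sum_{i=1}^{s+1}A_i$; every $A_i$ is again SPC (respectively PPT); $A$ is separable if and only if every $A_i$ is separable; and if $A$ is not weak irreducible, then every $A_i$ has strictly smaller tensor rank than $A$. 2. To decide whether $A$ is separable, it suffices to decide separability among weak irreducible matrices of the same type: $A$ has a split reduction, and for every split reduction $L$ of $A$, every member of $L$ is SPC (respectively PPT) and weak irreducible, and if $Q$ is any criterion such that, for every weak irreducible SPC (respectively PPT) matrix $B$ of the same size as $A$, $Q(B)$ holds if and only if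 $B$ is separable, then $A$ is separable if and only if $Q(B)$ holds for every $B$ in $L$. -/

import Mathlib

open scoped Kronecker ComplexOrder

/-- `M_k`, the complex `k × k` matrices. -/
abbrev Mat (k : ℕ) : Type := Matrix (Fin k) (Fin k) ℂ

/-- `M_k ⊗ M_m`, realised as `M_{km}` through the Kronecker product `⊗ₖ`. -/
abbrev BiMat (k m : ℕ) : Type := Matrix (Fin k × Fin m) (Fin k × Fin m) ℂ

/-- A finite family of matrices is orthonormal for `⟨C, D⟩ = tr (C D*)`. -/
def TraceOrthonormal {k : ℕ} {ι : Type} [DecidableEq ι] (γ : ι → Mat k) : Prop :=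
  ∀ i j, Matrix.trace (γ i * (γ j).conjTranspose) = if i = j then 1 else 0

/-- `A = ∑ i, c i • γ i ⊗ δ i` is a Hermitian Schmidt decomposition of `A`. The index type may be
empty, which gives the decomposition of `0`. -/
structure IsHermitianSchmidtDecomposition {k m : ℕ} {ι : Type} [Fintype ι] [DecidableEq ι]
    (A : BiMat k m) (c : ι → ℝ) (γ : ι → Mat k) (δ : ι → Mat m) : Prop where
  pos : ∀ i, 0 < c i
  left_hermitian : ∀ i, (γ i).IsHermitian
  right_hermitian : ∀ i, (δ i).IsHermitian
  left_orthonormal : TraceOrthonormal γ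
  right_orthonormal : TraceOrthonormal δ
  eq_sum : A = ∑ i, (c i : ℂ) • (γ i ⊗ₖ δ i)

/-- Symmetric with positive coefficients. -/
def IsSPC {k : ℕ} (A : BiMat k k) : Prop :=
  A.PosSemidef ∧ ∃ (n : ℕ) (c : Fin n → ℝ) (γ : Fin n → Mat k),
    IsHermitianSchmidtDecomposition A c γ γ

/-- Transposition in the first tensor factor. -/
def partialTranspose {k m : ℕ} (A : BiMat k m) : BiMat k m :=
  Matrix.of fun p q => A (q.1, p.2) (p.1, q.2)

/-- Positive under partial transposition. -/
def IsPPT {k m : ℕ} (A : BiMat k m) : Prop :=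
  A.PosSemidef ∧ (partialTranspose A).PosSemidef

/-- `A` is a finite sum of tensor products of positive semidefinite Hermitian matrices. -/
def IsSeparableMatrix {k m : ℕ} (A : BiMat k m) : Prop :=
  ∃ (n : ℕ) (C : Fin n → Mat k) (D : Fin n → Mat m),
    (∀ i, (C i).PosSemidef) ∧ (∀ i, (D i).PosSemidef) ∧ A = ∑ i, C i ⊗ₖ D i

/-- The least number of nonzero elementary tensors of which `A` is the sum. -/
noncomputable def tensorRank {k m : ℕ} (A : BiMat k m) : ℕ :=
  sInf {n : ℕ | ∃ (C : Fin n → Mat k) (D : Fin n → Mat m),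
    (∀ i, C i ⊗ₖ D i ≠ 0) ∧ A = ∑ i, C i ⊗ₖ D i}

/-- A Hermitian (that is, orthogonal) projection. -/
def IsHermitianProjection {k : ℕ} (P : Mat k) : Prop :=
  P.IsHermitian ∧ P * P = P

/-- The Hermitian projection onto `S`. -/
def IsHermitianProjectionOnto {k : ℕ} (P : Mat k) (S : Set (Fin k → ℂ)) : Prop :=
  IsHermitianProjection P ∧ Set.range P.mulVec = S

/-- The compression `(V ⊗ W) A (V ⊗ W)`. -/
def compress {k m : ℕ} (V : Mat k) (W : Mat m) (A : BiMat k m) : BiMat k m :=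
  (V ⊗ₖ W) * A * (V ⊗ₖ W)

/-- Weak irreducibility of a positive semidefinite Hermitian matrix. -/
def IsWeakIrreducible {k m : ℕ} (A : BiMat k m) : Prop :=
  A.PosSemidef ∧ ∀ (V₁ V₂ : Mat k) (W₁ W₂ : Mat m),
    IsHermitianProjection V₁ → IsHermitianProjection V₂ →
    IsHermitianProjection W₁ → IsHermitianProjection W₂ →
    V₁ * V₂ = 0 → W₁ * W₂ = 0 → V₁ + V₂ = 1 → W₁ + W₂ = 1 →
    A = compress V₁ W₁ A + compress V₂ W₂ A →
    compress V₁ W₁ A = 0 ∨ compress V₂ W₂ A = 0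

/-- `V 0, …, V (s - 1)` are the Hermitian projections onto the images of
`ε 0, …, ε (s - 1)`, and `V s` is the Hermitian projection onto the orthogonal complement of
the sum of these images. -/
def IsProjectionSystem {k s : ℕ} (ε : Fin s → Mat k) (V : Fin (s + 1) → Mat k) : Prop :=
  (∀ i : Fin s, IsHermitianProjectionOnto (V i.castSucc) (Set.range (ε i).mulVec)) ∧
  IsHermitianProjectionOnto (V (Fin.last s))
    {x | ∀ (i : Fin s) (y : Fin k → ℂ), star ((ε i).mulVec y) ⬝ᵥ x = 0}

/-- The data that enter a split decomposition of `A`: a Hermitian Schmidt decomposition of `A`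
with largest coefficient `μ`, of multiplicity `s ≥ 1` (the indices `Sum.inl i`), and other
coefficients `ν j < μ` (the indices `Sum.inr j`); a Hermitian Schmidt decomposition of
`D = ∑ i, γ (Sum.inl i) ⊗ δ (Sum.inl i)` with coefficients `1` and positive semidefinite
factors `γ' i`, `δ' i`; and the associated projections `V`, `W`. -/
structure IsSplitData {k m s t : ℕ} (A : BiMat k m) (μ : ℝ) (ν : Fin t → ℝ)
    (γ : Fin s ⊕ Fin t → Mat k) (δ : Fin s ⊕ Fin t → Mat m)
    (γ' : Fin s → Mat k) (δ' : Fin s → Mat m)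
    (V : Fin (s + 1) → Mat k) (W : Fin (s + 1) → Mat m) : Prop where
  one_le : 1 ≤ s
  lt_top : ∀ j, ν j < μ
  schmidt : IsHermitianSchmidtDecomposition A (Sum.elim (fun _ => μ) ν) γ δ
  schmidt_top : IsHermitianSchmidtDecomposition
    (∑ i : Fin s, γ (Sum.inl i) ⊗ₖ δ (Sum.inl i)) (fun _ => 1) γ' δ'
  left_posSemidef : ∀ i, (γ' i).PosSemidef
  right_posSemidef : ∀ i, (δ' i).PosSemidef
  left_projections : IsProjectionSystem γ' V
  right_projections : IsProjectionSystem δ' W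

/-- `T` lists the terms `(V i ⊗ W i) A (V i ⊗ W i)` of a split decomposition of `A`, in the form
used for PPT matrices. -/
def IsPPTSplitDecomposition {k m : ℕ} (s : ℕ) (A : BiMat k m)
    (T : Fin (s + 1) → BiMat k m) : Prop :=
  ∃ (t : ℕ) (μ : ℝ) (ν : Fin t → ℝ) (γ : Fin s ⊕ Fin t → Mat k) (δ : Fin s ⊕ Fin t → Mat m)
    (γ' : Fin s → Mat k) (δ' : Fin s → Mat m)
    (V : Fin (s + 1) → Mat k) (W : Fin (s + 1) → Mat m),
    IsSplitData A μ ν γ δ γ' δ' V W ∧ ∀ i, T i = compress (V i) (W i) A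

/-- `T` lists the terms `(V i ⊗ V i) A (V i ⊗ V i)` of a split decomposition of `A`, in the form
used for SPC matrices: the two tensor factors carry the same data. -/
def IsSPCSplitDecomposition {k : ℕ} (s : ℕ) (A : BiMat k k)
    (T : Fin (s + 1) → BiMat k k) : Prop :=
  ∃ (t : ℕ) (μ : ℝ) (ν : Fin t → ℝ) (γ : Fin s ⊕ Fin t → Mat k)
    (γ' : Fin s → Mat k) (V : Fin (s + 1) → Mat k),
    IsSplitData A μ ν γ γ γ' γ' V V ∧ ∀ i, T i = compress (V i) (V i) A

/-- `SplitReduction step A L`: the finite list `L` is what remains of `A` if every matrix that is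
not weak irreducible is replaced by the terms of a split decomposition of it (`step`), these
terms are treated in the same way, and so on, and the weak irreducible ones are kept. -/
inductive SplitReduction {k m : ℕ}
    (step : (s : ℕ) → BiMat k m → (Fin (s + 1) → BiMat k m) → Prop) :
    BiMat k m → List (BiMat k m) → Prop
  | keep (A : BiMat k m) : IsWeakIrreducible A → SplitReduction step A [A]
  | split (A : BiMat k m) (s : ℕ) (T : Fin (s + 1) → BiMat k m)
      (L : Fin (s + 1) → List (BiMat k m)) :
      ¬ IsWeakIrreducible A → step s A T → (∀ i, SplitReduction step (T i) (L i)) →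
      SplitReduction step A (List.ofFn L).flatten

/-! Regard `A` as the bilinear form (X, Y) ↦ tr(A (X ⊗ Y)); its singular values on Hermitian
matrices are the Schmidt coefficients. Let μ be the largest one, and (X, Y) a singular pair for μ
with both members positive semidefinite and support projections V, W. Then tr(A (X ⊗ (1 - W))) = μ
tr(Y (1 - W)) = 0, which positivity of `A` turns into A (V ⊗ (1 - W)) = 0; likewise with the factors
exchanged. So the mixed diagonal blocks vanish. The off-diagonal blocks then vanish by a
rearrangement of indices: partial transposition for PPT (`IsPPT.off_diagonal_eq_zero`), and a flip
that produces ∑ λᵢ ‖V γᵢ (1 - V)‖² = 0 for SPC (`IsSPC.off_diagonal_eq_zero`). Hence a split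
decomposition is a block diagonalisation, and separability can be tested on the blocks, since
compressions and sums preserve it.

Tensor rank drops as soon as another block is nonzero (`IsBlockDecomposition.tensorRank_lt`). Each
block belonging to a top pair is nonzero. If there is a single such pair and the remaining block is
zero, then `A` is weak irreducible (`IsSplitData.isWeakIrreducible`): a projection pair splitting
`A` sends the top pair to a multiple of itself, and the factor is 0 or 1.

For existence, the left members of top pairs form a real space E. Replacing (P - N, Q - R) by (P +
N, Q + R) keeps the norms and does not decrease the form, which is already maximal, so E is closed
under positive parts (`IsSingularPair.posPart`). By the splitting above E is also stable under
support projections of its positive members. Such a space has a basis of mutually annihilating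
positive semidefinite matrices (`exists_posSemidef_orthogonal_span`); normalised, and paired with
their partners, they give the required decomposition of the top part.

Recursion terminates because tensor rank strictly decreases. -/

namespace Matrix

/-! ### Positive semidefinite and Hermitian matrices -/

theorem IsHermitian.sum {n ι : Type*} (s : Finset ι) {f : ι → Matrix n n ℂ}
    (h : ∀ i ∈ s, (f i).IsHermitian) : (∑ i ∈ s, f i).IsHermitian := by
  rw [IsHermitian, conjTranspose_sum]
  exact Finset.sum_congr rfl h

theorem IsHermitian.real_smul {n : Type*} {X : Matrix n n ℂ} (hX : X.IsHermitian) (r : ℝ) :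
    ((r : ℂ) • X).IsHermitian := by
  rw [IsHermitian, conjTranspose_smul, hX.eq]
  simp

variable {n : Type*} [Fintype n]

theorem PosSemidef.exists_eq_conjTranspose_mul_self {A : Matrix n n ℂ} (hA : A.PosSemidef) :
    ∃ C : Matrix n n ℂ, A = Cᴴ * C := by
  classical
  open scoped MatrixOrder in
  exact CStarAlgebra.nonneg_iff_eq_star_mul_self.mp hA.nonneg

theorem PosSemidef.trace_mul_nonneg {A B : Matrix n n ℂ} (hA : A.PosSemidef)
    (hB : B.PosSemidef) : 0 ≤ (A * B).trace := by
  obtain ⟨C, rfl⟩ := hA.exists_eq_conjTranspose_mul_self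
  rw [Matrix.mul_assoc, trace_mul_comm]
  exact (hB.mul_mul_conjTranspose_same C).trace_nonneg

/-- For A = CᴴC and B = DᴴD the trace is the squared norm of C Dᴴ. This turns every scalar identity
below into a vanishing block. -/
theorem PosSemidef.mul_eq_zero_of_trace_mul_eq_zero {A B : Matrix n n ℂ} (hA : A.PosSemidef)
    (hB : B.PosSemidef) (h : (A * B).trace = 0) : A * B = 0 := by
  obtain ⟨C, rfl⟩ := hA.exists_eq_conjTranspose_mul_self
  obtain ⟨D, hD⟩ := hB.exists_eq_conjTranspose_mul_self
  rw [hD] at h ⊢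
  have h0 : C * Dᴴ = 0 := by
    rw [← trace_conjTranspose_mul_self_eq_zero_iff, conjTranspose_mul, conjTranspose_conjTranspose,
      ← h, trace_mul_comm, Matrix.mul_assoc, Matrix.mul_assoc, trace_mul_comm Cᴴ]
    simp only [Matrix.mul_assoc]
  rw [Matrix.mul_assoc, ← Matrix.mul_assoc C, h0]
  simp

theorem IsHermitian.exists_unitary_diagonal [DecidableEq n] {X : Matrix n n ℂ}
    (hX : X.IsHermitian) : ∃ (U : Matrix n n ℂ) (d : n → ℝ), Uᴴ * U = 1 ∧ U * Uᴴ = 1 ∧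
      X = U * diagonal (fun i => (d i : ℂ)) * Uᴴ := by
  refine ⟨hX.eigenvectorUnitary, hX.eigenvalues, ?_, ?_, ?_⟩
  · exact Unitary.coe_star_mul_self hX.eigenvectorUnitary
  · exact Unitary.coe_mul_star_self hX.eigenvectorUnitary
  · conv_lhs => rw [hX.spectral_theorem]
    rfl

theorem IsHermitian.exists_posSemidef_sub {X : Matrix n n ℂ} (hX : X.IsHermitian) :
    ∃ P N : Matrix n n ℂ, P.PosSemidef ∧ N.PosSemidef ∧ X = P - N ∧ P * N = 0 := by
  classical
  obtain ⟨U, d, h1, h2, rfl⟩ := hX.exists_unitary_diagonal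
  refine ⟨U * diagonal (fun i => ((max (d i) 0 : ℝ) : ℂ)) * Uᴴ,
    U * diagonal (fun i => ((max (-d i) 0 : ℝ) : ℂ)) * Uᴴ, ?_, ?_, ?_, ?_⟩
  · refine PosSemidef.mul_mul_conjTranspose_same (PosSemidef.diagonal fun i => ?_) U
    exact Complex.zero_le_real.mpr (le_max_right (d i) 0)
  · refine PosSemidef.mul_mul_conjTranspose_same (PosSemidef.diagonal fun i => ?_) U
    exact Complex.zero_le_real.mpr (le_max_right (-d i) 0)
  · rw [← Matrix.sub_mul, ← Matrix.mul_sub, diagonal_sub]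
    congr 3
    ext i
    rw [← Complex.ofReal_sub]
    congr 1
    rcases le_total (d i) 0 with h | h <;> simp [h]
  · have : ∀ D E : Matrix n n ℂ, U * D * Uᴴ * (U * E * Uᴴ) = U * (D * E) * Uᴴ := by
      intro D E
      calc U * D * Uᴴ * (U * E * Uᴴ) = U * D * (Uᴴ * U) * E * Uᴴ := by
            simp only [Matrix.mul_assoc]
        _ = _ := by rw [h1]; simp only [Matrix.mul_one, Matrix.mul_assoc]
    rw [this, diagonal_mul_diagonal]
    have h0 : (fun i => ((max (d i) 0 : ℝ) : ℂ) * ((max (-d i) 0 : ℝ) : ℂ)) = 0 := by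
      ext i
      rcases le_total (d i) 0 with h | h <;> simp [h]
    rw [h0]
    simp

/-- The support projection of a Hermitian matrix. -/
theorem IsHermitian.exists_support_projection {X : Matrix n n ℂ} (hX : X.IsHermitian) :
    ∃ V Z : Matrix n n ℂ, V.IsHermitian ∧ V * V = V ∧ V * X = X ∧ V = X * Z := by
  classical
  obtain ⟨U, d, h1, h2, rfl⟩ := hX.exists_unitary_diagonal
  have key : ∀ D E : Matrix n n ℂ, U * D * Uᴴ * (U * E * Uᴴ) = U * (D * E) * Uᴴ := by
    intro D E
    calc U * D * Uᴴ * (U * E * Uᴴ) = U * D * (Uᴴ * U) * E * Uᴴ := by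
          simp only [Matrix.mul_assoc]
      _ = _ := by rw [h1]; simp only [Matrix.mul_one, Matrix.mul_assoc]
  refine ⟨U * diagonal (fun i => if d i = 0 then 0 else 1) * Uᴴ,
    U * diagonal (fun i => ((d i : ℂ))⁻¹) * Uᴴ, ?_, ?_, ?_, ?_⟩
  · refine isHermitian_mul_mul_conjTranspose U (isHermitian_diagonal_of_self_adjoint _ ?_)
    ext i
    by_cases h : d i = 0 <;> simp [h]
  · rw [key, diagonal_mul_diagonal]
    congr 3
    ext i
    by_cases h : d i = 0 <;> simp [h]
  · rw [key, diagonal_mul_diagonal]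
    congr 3
    ext i
    by_cases h : d i = 0 <;> simp [h]
  · rw [key, diagonal_mul_diagonal]
    congr 3
    ext i
    by_cases h : d i = 0 <;> simp [h]

theorem IsHermitian.trace_mul_eq_re {X Y : Matrix n n ℂ} (hX : X.IsHermitian)
    (hY : Y.IsHermitian) : (X * Y).trace = ((X * Y).trace.re : ℂ) := by
  refine (Complex.conj_eq_iff_re.mp ?_).symm
  rw [starRingEnd_apply, ← trace_conjTranspose, conjTranspose_mul, hX.eq, hY.eq, trace_mul_comm]

theorem IsHermitian.eq_zero_of_trace_mul_self {X : Matrix n n ℂ} (hX : X.IsHermitian)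
    (h : (X * X).trace.re = 0) : X = 0 := by
  rw [← trace_conjTranspose_mul_self_eq_zero_iff, hX.eq, hX.trace_mul_eq_re hX, h]
  rfl

theorem IsHermitian.trace_mul_self_nonneg {X : Matrix n n ℂ} (hX : X.IsHermitian) :
    0 ≤ (X * X).trace.re := by
  have := (posSemidef_conjTranspose_mul_self X).trace_nonneg
  rw [hX.eq] at this
  exact (Complex.le_def.mp this).1

end Matrix

open Matrix

/-! ### Kronecker products, traces and partial transposition -/

section Kronecker

variable {k m : ℕ}

@[elab_as_elim]
theorem BiMat.kronecker_induction {P : BiMat k m → Prop} (A : BiMat k m) (zero : P 0)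
    (add : ∀ A B, P A → P B → P (A + B)) (kronecker : ∀ X Y, P (X ⊗ₖ Y)) : P A := by
  induction A using Matrix.induction_on' with
  | h_zero => exact zero
  | h_add A B hA hB => exact add A B hA hB
  | h_std_basis p q x =>
    have := kronecker (single p.1 q.1 x) (single p.2 q.2 1)
    rwa [single_kronecker_single, mul_one] at this

theorem trace_mul_kronecker_ext {A B : BiMat k m}
    (h : ∀ X Y, (A * (X ⊗ₖ Y)).trace = (B * (X ⊗ₖ Y)).trace) : A = B := by
  refine Matrix.ext_iff_trace_mul_right.mpr fun M => ?_
  induction M using BiMat.kronecker_induction with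
  | zero => simp
  | add M N hM hN => simp [Matrix.mul_add, hM, hN]
  | kronecker X Y => exact h X Y

theorem trace_kronecker_mul_kronecker (X Z : Mat k) (Y T : Mat m) :
    ((X ⊗ₖ Y) * (Z ⊗ₖ T)).trace = (X * Z).trace * (Y * T).trace := by
  rw [← mul_kronecker_mul, trace_kronecker]

theorem sum_kronecker {ι : Type*} (s : Finset ι) (f : ι → Mat k) (Y : Mat m) :
    (∑ i ∈ s, f i) ⊗ₖ Y = ∑ i ∈ s, f i ⊗ₖ Y :=
  map_sum ((kroneckerBilinear (R := ℂ) (α := ℂ) (l := Fin k) (m := Fin k) (n := Fin m)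
    (p := Fin m)).flip Y) f s

theorem kronecker_sum {ι : Type*} (s : Finset ι) (X : Mat k) (f : ι → Mat m) :
    X ⊗ₖ (∑ i ∈ s, f i) = ∑ i ∈ s, X ⊗ₖ f i :=
  map_sum (kroneckerBilinear (R := ℂ) (α := ℂ) (l := Fin k) (m := Fin k) (n := Fin m)
    (p := Fin m) X) f s

theorem sub_kronecker (X X' : Mat k) (Y : Mat m) : (X - X') ⊗ₖ Y = X ⊗ₖ Y - X' ⊗ₖ Y := by
  ext
  simp [sub_mul]

theorem kronecker_sub (X : Mat k) (Y Y' : Mat m) : X ⊗ₖ (Y - Y') = X ⊗ₖ Y - X ⊗ₖ Y' := by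
  ext
  simp [mul_sub]

theorem trace_mul_smul_kronecker_sum {ι : Type*} [Fintype ι] (c : ι → ℂ) (γ : ι → Mat k)
    (δ : ι → Mat m) (X : Mat k) (Y : Mat m) :
    ((∑ i, c i • (γ i ⊗ₖ δ i)) * (X ⊗ₖ Y)).trace =
      ∑ i, c i * ((γ i * X).trace * (δ i * Y).trace) := by
  simp [Matrix.sum_mul, trace_sum, trace_kronecker_mul_kronecker]

theorem partialTranspose_add (A B : BiMat k m) :
    partialTranspose (A + B) = partialTranspose A + partialTranspose B := rfl

theorem partialTranspose_zero : partialTranspose (0 : BiMat k m) = 0 := rfl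

theorem partialTranspose_kronecker (X : Mat k) (Y : Mat m) :
    partialTranspose (X ⊗ₖ Y) = Xᵀ ⊗ₖ Y := rfl

theorem partialTranspose_partialTranspose (A : BiMat k m) :
    partialTranspose (partialTranspose A) = A := rfl

/-- The first-factor multipliers change sides while the second-factor ones stay. Off-diagonal blocks
of a matrix thereby become mixed diagonal blocks of its partial transpose. -/
theorem partialTranspose_kronecker_mul_mul_kronecker (A : BiMat k m) (P R : Mat k) (Q S : Mat m) :
    partialTranspose ((P ⊗ₖ Q) * A * (R ⊗ₖ S)) = (Rᵀ ⊗ₖ Q) * partialTranspose A * (Pᵀ ⊗ₖ S) := by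
  induction A using BiMat.kronecker_induction with
  | zero => simp [partialTranspose_zero]
  | add A B hA hB => simp only [Matrix.mul_add, Matrix.add_mul, partialTranspose_add, hA, hB]
  | kronecker X Y =>
    simp only [← mul_kronecker_mul, partialTranspose_kronecker, transpose_mul, Matrix.mul_assoc]

theorem trace_partialTranspose_mul (A : BiMat k m) (X : Mat k) (Y : Mat m) :
    (partialTranspose A * (X ⊗ₖ Y)).trace = (A * (Xᵀ ⊗ₖ Y)).trace := by
  induction A using BiMat.kronecker_induction with
  | zero => simp [partialTranspose_zero]
  | add A B hA hB => simp only [Matrix.add_mul, partialTranspose_add, trace_add, hA, hB]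
  | kronecker Z T =>
    simp only [partialTranspose_kronecker, trace_kronecker_mul_kronecker]
    rw [← trace_transpose (Zᵀ * X), transpose_mul, transpose_transpose, trace_mul_comm]

end Kronecker

/-! ### Compressions and the vanishing of off-diagonal blocks -/

section Projection

variable {k m : ℕ}

theorem IsHermitianProjection.posSemidef {P : Mat k} (h : IsHermitianProjection P) :
    P.PosSemidef := by
  rw [← h.2]
  nth_rw 1 [← h.1.eq]
  exact posSemidef_conjTranspose_mul_self P

theorem IsHermitianProjection.one_sub {P : Mat k} (h : IsHermitianProjection P) :
    IsHermitianProjection (1 - P) :=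
  ⟨isHermitian_one.sub h.1, by simp [Matrix.mul_sub, Matrix.sub_mul, h.2]⟩

theorem IsHermitianProjection.transpose {P : Mat k} (h : IsHermitianProjection P) :
    IsHermitianProjection Pᵀ :=
  ⟨h.1.transpose, by rw [← transpose_mul, h.2]⟩

theorem IsHermitianProjection.mul_eq_zero_comm {P Q : Mat k} (hP : IsHermitianProjection P)
    (hQ : IsHermitianProjection Q) (h : P * Q = 0) : Q * P = 0 := by
  rw [← hP.1.eq, ← hQ.1.eq, ← conjTranspose_mul, h, conjTranspose_zero]

theorem isHermitian_kronecker {X : Mat k} {Y : Mat m} (hX : X.IsHermitian) (hY : Y.IsHermitian) :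
    (X ⊗ₖ Y).IsHermitian := by
  rw [IsHermitian, conjTranspose_kronecker, hX.eq, hY.eq]

theorem compress_posSemidef {A : BiMat k m} (hA : A.PosSemidef) {V : Mat k} {W : Mat m}
    (hV : V.IsHermitian) (hW : W.IsHermitian) : (compress V W A).PosSemidef := by
  have := hA.mul_mul_conjTranspose_same (V ⊗ₖ W)
  rwa [(isHermitian_kronecker hV hW).eq] at this

theorem compress_kronecker (V : Mat k) (W : Mat m) (X : Mat k) (Y : Mat m) :
    compress V W (X ⊗ₖ Y) = (V * X * V) ⊗ₖ (W * Y * W) := by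
  simp only [compress, ← mul_kronecker_mul]

theorem compress_sum {ι : Type*} (s : Finset ι) (V : Mat k) (W : Mat m) (f : ι → BiMat k m) :
    compress V W (∑ i ∈ s, f i) = ∑ i ∈ s, compress V W (f i) := by
  simp only [compress, Matrix.mul_sum, Matrix.sum_mul]

theorem compress_smul (V : Mat k) (W : Mat m) (c : ℂ) (A : BiMat k m) :
    compress V W (c • A) = c • compress V W A := by
  simp only [compress, Matrix.mul_smul, Matrix.smul_mul]

theorem mul_kronecker_eq_zero {A : BiMat k m} (hA : A.PosSemidef) {X : Mat k} {Y : Mat m}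
    (hX : X.PosSemidef) (hY : Y.PosSemidef) (h : (A * (X ⊗ₖ Y)).trace = 0) :
    A * (X ⊗ₖ Y) = 0 :=
  hA.mul_eq_zero_of_trace_mul_eq_zero (hX.kronecker hY) h

theorem IsPPT.compress {A : BiMat k m} (hA : IsPPT A) {V : Mat k} {W : Mat m}
    (hV : V.IsHermitian) (hW : W.IsHermitian) : IsPPT (compress V W A) := by
  refine ⟨compress_posSemidef hA.1 hV hW, ?_⟩
  rw [_root_.compress, partialTranspose_kronecker_mul_mul_kronecker]
  exact compress_posSemidef hA.2 hV.transpose hW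

/-- Off-diagonal blocks of a PPT matrix vanish as soon as one mixed diagonal block does. -/
theorem IsPPT.off_diagonal_eq_zero {A : BiMat k m} (hA : IsPPT A) {V₁ V₂ : Mat k} {W₁ W₂ : Mat m}
    (hV₁ : IsHermitianProjection V₁) (hW₂ : IsHermitianProjection W₂)
    (h : A * (V₁ ⊗ₖ W₂) = 0) : (V₁ ⊗ₖ W₁) * A * (V₂ ⊗ₖ W₂) = 0 := by
  -- The mixed block has the same trace in `A` and in its partial transpose, and the latter is
  -- positive semidefinite too.
  have h1 : partialTranspose A * (V₁ᵀ ⊗ₖ W₂) = 0 := by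
    refine mul_kronecker_eq_zero hA.2 hV₁.transpose.posSemidef hW₂.posSemidef ?_
    rw [trace_partialTranspose_mul, transpose_transpose, h, trace_zero]
  rw [← partialTranspose_partialTranspose ((V₁ ⊗ₖ W₁) * A * (V₂ ⊗ₖ W₂)),
    partialTranspose_kronecker_mul_mul_kronecker, Matrix.mul_assoc, h1, Matrix.mul_zero,
    partialTranspose_zero]

/-- Off-diagonal blocks of an SPC matrix vanish as soon as one mixed diagonal block does. -/
theorem IsSPC.off_diagonal_eq_zero {A : BiMat k k} (hA : IsSPC A) {V₁ V₂ : Mat k}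
    (hV₁ : IsHermitianProjection V₁) (hV₂ : IsHermitianProjection V₂)
    (h : A * (V₁ ⊗ₖ V₂) = 0) : (V₁ ⊗ₖ V₁) * A * (V₂ ⊗ₖ V₂) = 0 := by
  obtain ⟨-, n, c, γ, hc⟩ := hA
  have h1 : ∑ i, (c i : ℂ) * ((V₁ * γ i * V₂)ᴴ * (V₁ * γ i * V₂)).trace = 0 := by
    have h0 : (V₂ ⊗ₖ V₁) * A * (V₁ ⊗ₖ V₂) = 0 := by rw [Matrix.mul_assoc, h, Matrix.mul_zero]
    rw [hc.eq_sum] at h0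
    simp only [Matrix.mul_sum, Matrix.sum_mul, Matrix.mul_smul, Matrix.smul_mul,
      ← mul_kronecker_mul] at h0
    -- This functional is the trace against the flip: it sends X ⊗ Y to tr(XY). On (V₂ γ V₁) ⊗ (V₁ γ
    -- V₂) it gives the squared norm of V₁ γ V₂.
    have h0' := congrArg (fun M : BiMat k k => ∑ p, ∑ q, M (p, q) (q, p)) h0
    simp only [Matrix.sum_apply, Matrix.smul_apply, kronecker_apply, Matrix.zero_apply,
      Finset.sum_const_zero, smul_eq_mul] at h0'
    rw [← h0', Finset.sum_congr rfl fun p _ => Finset.sum_comm, Finset.sum_comm]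
    refine Finset.sum_congr rfl fun i _ => ?_
    simp only [conjTranspose_mul, hV₁.1.eq, hV₂.1.eq, (hc.left_hermitian i).eq, Matrix.trace,
      Matrix.diag_apply, Finset.mul_sum]
    refine Finset.sum_congr rfl fun p _ => ?_
    rw [← Matrix.mul_assoc V₂, Matrix.mul_apply, Finset.mul_sum]
  have h2 : ∀ i, V₁ * γ i * V₂ = 0 := by
    intro i
    rw [← trace_conjTranspose_mul_self_eq_zero_iff]
    have h3 := (Finset.sum_eq_zero_iff_of_nonneg (fun j _ => mul_nonneg
      (Complex.zero_le_real.mpr (hc.pos j).le)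
      (posSemidef_conjTranspose_mul_self (V₁ * γ j * V₂)).trace_nonneg)).mp h1 i
      (Finset.mem_univ i)
    exact (mul_eq_zero.mp h3).resolve_left (Complex.ofReal_ne_zero.mpr (hc.pos i).ne')
  rw [hc.eq_sum]
  simp only [Matrix.mul_sum, Matrix.sum_mul, Matrix.mul_smul, Matrix.smul_mul, ← mul_kronecker_mul,
    h2, zero_kronecker, smul_zero, Finset.sum_const_zero]

end Projection

/-! ### Block decompositions, separability and tensor rank -/

section Blocks

variable {k m : ℕ}

/-- Orthogonal resolutions of the identity in both factors with respect to which `A` is block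
diagonal. -/
structure IsBlockDecomposition {ι : Type*} [Fintype ι] (A : BiMat k m) (V : ι → Mat k)
    (W : ι → Mat m) : Prop where
  left_projection : ∀ i, IsHermitianProjection (V i)
  right_projection : ∀ i, IsHermitianProjection (W i)
  left_orthogonal : ∀ i j, i ≠ j → V i * V j = 0
  right_orthogonal : ∀ i j, i ≠ j → W i * W j = 0
  left_sum : ∑ i, V i = 1
  right_sum : ∑ i, W i = 1
  mixed : ∀ i j, i ≠ j → A * (V i ⊗ₖ W j) = 0
  off_diagonal : ∀ i j, i ≠ j → (V i ⊗ₖ W i) * A * (V j ⊗ₖ W j) = 0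

namespace IsBlockDecomposition

variable {ι : Type*} [Fintype ι] {A : BiMat k m} {V : ι → Mat k} {W : ι → Mat m}

theorem eq_sum (h : IsBlockDecomposition A V W) (hA : A.IsHermitian) :
    A = ∑ i, compress (V i) (W i) A := by
  classical
  have h1 : A = A * ∑ i, V i ⊗ₖ W i := by
    conv_lhs => rw [← Matrix.mul_one A, ← one_kronecker_one, ← h.left_sum, ← h.right_sum,
      sum_kronecker, Matrix.mul_sum]
    rw [Matrix.mul_sum]
    refine Finset.sum_congr rfl fun i _ => ?_
    rw [kronecker_sum, Matrix.mul_sum, Finset.sum_eq_single i (fun j _ hj => h.mixed i j hj.symm)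
      (by simp)]
  have h2 : A = (∑ i, V i ⊗ₖ W i) * A := by
    have h3 : (∑ i, V i ⊗ₖ W i).IsHermitian := IsHermitian.sum _ fun i _ =>
      isHermitian_kronecker (h.left_projection i).1 (h.right_projection i).1
    conv_lhs => rw [← hA.eq, h1, conjTranspose_mul, h3.eq, hA.eq]
  calc A = ∑ i, A * (V i ⊗ₖ W i) := by rw [← Matrix.mul_sum, ← h1]
    _ = ∑ i, compress (V i) (W i) A := Finset.sum_congr rfl fun i _ => by
      conv_lhs => rw [h2]
      rw [Matrix.sum_mul, Matrix.sum_mul, Finset.sum_eq_single i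
        (fun j _ hj => h.off_diagonal j i hj) (by simp), compress]

theorem compress_compress_eq_zero (h : IsBlockDecomposition A V W) {i j : ι} (hij : i ≠ j) :
    compress (V i) (W j) A = 0 := by
  rw [compress, Matrix.mul_assoc, h.mixed i j hij, Matrix.mul_zero]

end IsBlockDecomposition

theorem isSeparableMatrix_of_fintype {ι : Type*} [Fintype ι] {C : ι → Mat k} {D : ι → Mat m}
    (hC : ∀ i, (C i).PosSemidef) (hD : ∀ i, (D i).PosSemidef) :
    IsSeparableMatrix (∑ i, C i ⊗ₖ D i) :=
  ⟨Fintype.card ι, fun i => C ((Fintype.equivFin ι).symm i),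
    fun i => D ((Fintype.equivFin ι).symm i), fun _ => hC _, fun _ => hD _,
    ((Fintype.equivFin ι).symm.sum_comp fun i => C i ⊗ₖ D i).symm⟩

theorem IsSeparableMatrix.compress {A : BiMat k m} (hA : IsSeparableMatrix A) {V : Mat k}
    {W : Mat m} (hV : V.IsHermitian) (hW : W.IsHermitian) :
    IsSeparableMatrix (compress V W A) := by
  obtain ⟨n, C, D, hC, hD, rfl⟩ := hA
  refine ⟨n, fun i => V * C i * V, fun i => W * D i * W, fun i => ?_, fun i => ?_, ?_⟩
  · simpa only [hV.eq] using (hC i).mul_mul_conjTranspose_same V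
  · simpa only [hW.eq] using (hD i).mul_mul_conjTranspose_same W
  · simp only [compress_sum, compress_kronecker]

theorem IsSeparableMatrix.sum {ι : Type*} [Fintype ι] {T : ι → BiMat k m}
    (h : ∀ i, IsSeparableMatrix (T i)) : IsSeparableMatrix (∑ i, T i) := by
  choose n C D hC hD hT using h
  have : ∑ i, T i = ∑ p : (i : ι) × Fin (n i), C p.1 p.2 ⊗ₖ D p.1 p.2 := by
    rw [Fintype.sum_sigma]
    exact Finset.sum_congr rfl fun i _ => hT i
  rw [this]
  exact isSeparableMatrix_of_fintype (fun p => hC p.1 p.2) (fun p => hD p.1 p.2)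

theorem IsBlockDecomposition.isSeparableMatrix_iff {ι : Type*} [Fintype ι] {A : BiMat k m}
    {V : ι → Mat k} {W : ι → Mat m} (h : IsBlockDecomposition A V W) (hA : A.IsHermitian) :
    IsSeparableMatrix A ↔ ∀ i, IsSeparableMatrix (compress (V i) (W i) A) := by
  refine ⟨fun hs i => hs.compress (h.left_projection i).1 (h.right_projection i).1, fun hs => ?_⟩
  rw [h.eq_sum hA]
  exact IsSeparableMatrix.sum hs

/-- `tensorRank` counts nonzero tensors only; discarding the zero terms lets any decomposition bound
it. -/
theorem exists_sum_kronecker_ne_zero {ι : Type*} [Fintype ι] (C : ι → Mat k) (D : ι → Mat m) :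
    ∃ n ≤ Fintype.card ι, ∃ (C' : Fin n → Mat k) (D' : Fin n → Mat m),
      (∀ i, C' i ⊗ₖ D' i ≠ 0) ∧ ∑ i, C i ⊗ₖ D i = ∑ i, C' i ⊗ₖ D' i := by
  classical
  let s := {i // C i ⊗ₖ D i ≠ 0}
  refine ⟨Fintype.card s, Fintype.card_subtype_le _, fun i => C ((Fintype.equivFin s).symm i).1,
    fun i => D ((Fintype.equivFin s).symm i).1, fun i => ((Fintype.equivFin s).symm i).2, ?_⟩
  rw [(Fintype.equivFin s).symm.sum_comp fun i : s => C i.1 ⊗ₖ D i.1,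
    ← Fintype.sum_subtype_add_sum_subtype (fun i => C i ⊗ₖ D i ≠ 0)]
  refine add_eq_left.mpr (Finset.sum_eq_zero fun i _ => not_not.mp i.2)

theorem tensorRank_le_card {ι : Type*} [Fintype ι] (C : ι → Mat k) (D : ι → Mat m) :
    tensorRank (∑ i, C i ⊗ₖ D i) ≤ Fintype.card ι := by
  obtain ⟨n, hn, C', D', h0, h⟩ := exists_sum_kronecker_ne_zero C D
  have hle : tensorRank (∑ i, C i ⊗ₖ D i) ≤ n := Nat.sInf_le ⟨C', D', h0, h⟩
  exact hle.trans hn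

theorem exists_sum_kronecker_tensorRank (A : BiMat k m) :
    ∃ (C : Fin (tensorRank A) → Mat k) (D : Fin (tensorRank A) → Mat m),
      A = ∑ i, C i ⊗ₖ D i := by
  have hne : {n : ℕ | ∃ (C : Fin n → Mat k) (D : Fin n → Mat m),
      (∀ i, C i ⊗ₖ D i ≠ 0) ∧ A = ∑ i, C i ⊗ₖ D i}.Nonempty := by
    have : ∃ (n : ℕ) (C : Fin n → Mat k) (D : Fin n → Mat m), A = ∑ i, C i ⊗ₖ D i := by
      induction A using BiMat.kronecker_induction with
      | zero => exact ⟨0, 0, 0, by simp⟩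
      | kronecker X Y => exact ⟨1, fun _ => X, fun _ => Y, by simp⟩
      | add A B hA hB =>
        obtain ⟨n, C, D, rfl⟩ := hA
        obtain ⟨n', C', D', rfl⟩ := hB
        exact ⟨n + n', Fin.append C C', Fin.append D D', by simp [Fin.sum_univ_add]⟩
    obtain ⟨n, C, D, rfl⟩ := this
    obtain ⟨n', -, C', D', h0, h⟩ := exists_sum_kronecker_ne_zero C D
    exact ⟨n', C', D', h0, h⟩
  obtain ⟨C, D, -, h⟩ := Nat.sInf_mem hne
  exact ⟨C, D, h⟩

theorem LinearIndependent.eq_zero_of_sum_kronecker_eq_zero {ι : Type*} [Fintype ι]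
    {C : ι → Mat k} {D : ι → Mat m} (hC : LinearIndependent ℂ C)
    (h : ∑ i, C i ⊗ₖ D i = 0) (i : ι) : D i = 0 := by
  ext p q
  refine Fintype.linearIndependent_iff.mp hC (fun j => D j p q) ?_ i
  ext a b
  have := congrFun (congrFun h (a, p)) (b, q)
  simpa [Matrix.sum_apply, mul_comm] using this

/-- Take a shortest sum ∑ C_l ⊗ D_l. Were the matrices V_i C_l V_i independent, the vanishing mixed
block (i, j) would force every W_j D_l W_j to be 0, hence block j to be 0. So they are dependent,
and block i can do with one term fewer. -/
theorem IsBlockDecomposition.tensorRank_lt {ι : Type*} [Fintype ι] {A : BiMat k m}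
    {V : ι → Mat k} {W : ι → Mat m} (h : IsBlockDecomposition A V W) {i j : ι} (hij : i ≠ j)
    (hj : compress (V j) (W j) A ≠ 0) :
    tensorRank (compress (V i) (W i) A) < tensorRank A := by
  classical
  obtain ⟨C, D, hA⟩ := exists_sum_kronecker_tensorRank A
  have h1 : ¬ LinearIndependent ℂ fun l => V i * C l * V i := by
    intro hli
    refine hj ?_
    have h0 := h.compress_compress_eq_zero hij
    rw [hA] at h0 ⊢
    simp only [compress_sum, compress_kronecker] at h0 ⊢
    simp only [hli.eq_zero_of_sum_kronecker_eq_zero h0, kronecker_zero, Finset.sum_const_zero]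
  obtain ⟨g, hg, l₀, hl₀⟩ := Fintype.not_linearIndependent_iff.mp h1
  have h2 : V i * C l₀ * V i =
      ∑ l : {l // l ≠ l₀}, (-(g l₀)⁻¹ * g l) • (V i * C l * V i) := by
    rw [← Fintype.sum_subtype_add_sum_subtype (fun l => l ≠ l₀)] at hg
    have h3 : ∑ l : {l // ¬ l ≠ l₀}, g l • (V i * C l * V i) = g l₀ • (V i * C l₀ * V i) := by
      rw [Fintype.sum_eq_single ⟨l₀, by simp⟩]
      rintro ⟨l, hl⟩ hne
      exact absurd (Subtype.ext (not_not.mp hl)) hne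
    rw [h3] at hg
    simp only [mul_smul, ← Finset.smul_sum]
    rw [eq_neg_of_add_eq_zero_left hg, smul_neg, neg_smul, neg_neg, smul_smul,
      inv_mul_cancel₀ hl₀, one_smul]
  -- The term of `l₀` is distributed over the others by absorbing its coefficients into the right
  -- factors.
  have h3 : compress (V i) (W i) A = ∑ l : {l // l ≠ l₀},
      (V i * C l * V i) ⊗ₖ (W i * D l * W i + (-(g l₀)⁻¹ * g l) • (W i * D l₀ * W i)) := by
    conv_lhs => rw [hA]
    simp only [compress_sum, compress_kronecker]
    rw [← Fintype.sum_subtype_add_sum_subtype (fun l => l ≠ l₀)]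
    have h3 : ∑ l : {l // ¬ l ≠ l₀}, (V i * C l * V i) ⊗ₖ (W i * D l * W i) =
        (V i * C l₀ * V i) ⊗ₖ (W i * D l₀ * W i) := by
      rw [Fintype.sum_eq_single ⟨l₀, by simp⟩]
      rintro ⟨l, hl⟩ hne
      exact absurd (Subtype.ext (not_not.mp hl)) hne
    rw [h3, h2, sum_kronecker, ← Finset.sum_add_distrib]
    refine Finset.sum_congr rfl fun l _ => ?_
    rw [kronecker_add, smul_kronecker, kronecker_smul]
  rw [h3]
  refine (tensorRank_le_card _ _).trans_lt ?_
  conv_rhs => rw [← Fintype.card_fin (tensorRank A)]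
  exact Fintype.card_subtype_lt (x := l₀) (by simp)

end Blocks

/-! ### Singular pairs for the largest Schmidt coefficient -/

section SingularPair

variable {k m : ℕ}

/-- `(X, Y)` is a pair of Hermitian singular vectors, with singular value `μ`, of the bilinear form
`(X, Y) ↦ tr (A (X ⊗ Y))`. -/
structure IsSingularPair (A : BiMat k m) (μ : ℝ) (X : Mat k) (Y : Mat m) : Prop where
  left_hermitian : X.IsHermitian
  right_hermitian : Y.IsHermitian
  trace_left : ∀ Z, (A * (X ⊗ₖ Z)).trace = μ * (Y * Z).trace
  trace_right : ∀ Z, (A * (Z ⊗ₖ Y)).trace = μ * (X * Z).trace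

/-- Multiplying `A` by V ⊗ 1 or by 1 ⊗ W, on either side, cuts out the same block. A projection can
therefore be moved from one tensor factor to the other. -/
theorem kronecker_one_mul_comm_of_block {A : BiMat k m} (hA : A.IsHermitian) {V : Mat k}
    {W : Mat m} (hV : IsHermitianProjection V) (hW : IsHermitianProjection W)
    (h : A = compress V W A + compress (1 - V) (1 - W) A) :
    (V ⊗ₖ 1) * A = A * (V ⊗ₖ 1) ∧ (1 ⊗ₖ W) * A = (V ⊗ₖ 1) * A ∧ (1 ⊗ₖ W) * A = A * (1 ⊗ₖ W) := by
  have hV0 : V * (1 - V) = 0 := by rw [Matrix.mul_sub, hV.2, Matrix.mul_one, sub_self]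
  have hW0 : W * (1 - W) = 0 := by rw [Matrix.mul_sub, hW.2, Matrix.mul_one, sub_self]
  have h1 : (V ⊗ₖ 1) * A = compress V W A := by
    conv_lhs => rw [h]
    simp only [compress, Matrix.mul_add, ← Matrix.mul_assoc, ← mul_kronecker_mul, hV.2, hV0,
      Matrix.one_mul, zero_kronecker, Matrix.zero_mul, add_zero]
  have h2 : (1 ⊗ₖ W) * A = compress V W A := by
    conv_lhs => rw [h]
    simp only [compress, Matrix.mul_add, ← Matrix.mul_assoc, ← mul_kronecker_mul, hW.2, hW0,
      Matrix.one_mul, kronecker_zero, Matrix.zero_mul, add_zero]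
  have h3 : (compress V W A).IsHermitian := by
    have h4 := (isHermitian_kronecker hV.1 hW.1).eq
    rw [IsHermitian, compress, conjTranspose_mul, conjTranspose_mul, h4, hA.eq, Matrix.mul_assoc]
  have h5 : A * (V ⊗ₖ 1) = compress V W A := by
    rw [← h3.eq, ← h1, conjTranspose_mul, hA.eq, (isHermitian_kronecker hV.1 isHermitian_one).eq]
  have h6 : A * (1 ⊗ₖ W) = compress V W A := by
    rw [← h3.eq, ← h2, conjTranspose_mul, hA.eq, (isHermitian_kronecker isHermitian_one hW.1).eq]
  exact ⟨h1.trans h5.symm, h2.trans h1.symm, h2.trans h6.symm⟩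

namespace IsSingularPair

variable {A : BiMat k m} {μ : ℝ} {X X' : Mat k} {Y Y' : Mat m}

theorem right_unique (hμ : μ ≠ 0) (h : IsSingularPair A μ X Y) (h' : IsSingularPair A μ X Y') :
    Y = Y' := by
  refine Matrix.ext_iff_trace_mul_right.mpr fun Z => ?_
  have := (h.trace_left Z).symm.trans (h'.trace_left Z)
  exact mul_left_cancel₀ (Complex.ofReal_ne_zero.mpr hμ) this

/-- Singular pairs are compatible with block decompositions. -/
theorem block (h : IsSingularPair A μ X Y) (hμ : μ ≠ 0) (hA : A.IsHermitian) {V : Mat k}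
    {W : Mat m} (hV : IsHermitianProjection V) (hW : IsHermitianProjection W)
    (hVW : A = compress V W A + compress (1 - V) (1 - W) A) :
    V * X = X * V ∧ W * Y = Y * W ∧ IsSingularPair A μ (V * X) (W * Y) := by
  obtain ⟨h1, h2, h3⟩ := kronecker_one_mul_comm_of_block hA hV hW hVW
  -- Inserting V in the left argument or W in the right one, on either side, always gives the same
  -- trace.
  have eVl : ∀ Z T, (A * ((V * Z) ⊗ₖ T)).trace = (((V ⊗ₖ 1) * A) * (Z ⊗ₖ T)).trace := by
    intro Z T
    rw [h1, Matrix.mul_assoc, ← mul_kronecker_mul, Matrix.one_mul]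
  have eVr : ∀ Z T, (A * ((Z * V) ⊗ₖ T)).trace = (((V ⊗ₖ 1) * A) * (Z ⊗ₖ T)).trace := by
    intro Z T
    rw [Matrix.mul_assoc, trace_mul_comm (V ⊗ₖ 1), Matrix.mul_assoc, ← mul_kronecker_mul,
      Matrix.mul_one]
  have eWl : ∀ Z T, (A * (Z ⊗ₖ (W * T))).trace = (((V ⊗ₖ 1) * A) * (Z ⊗ₖ T)).trace := by
    intro Z T
    rw [← h2, h3, Matrix.mul_assoc, ← mul_kronecker_mul, Matrix.one_mul]
  have eWr : ∀ Z T, (A * (Z ⊗ₖ (T * W))).trace = (((V ⊗ₖ 1) * A) * (Z ⊗ₖ T)).trace := by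
    intro Z T
    rw [← h2, Matrix.mul_assoc, trace_mul_comm (1 ⊗ₖ W), Matrix.mul_assoc, ← mul_kronecker_mul,
      Matrix.mul_one]
  have hμ' : (μ : ℂ) ≠ 0 := Complex.ofReal_ne_zero.mpr hμ
  have hX : V * X = X * V := by
    refine Matrix.ext_iff_trace_mul_right.mpr fun Z => mul_left_cancel₀ hμ' ?_
    rw [Matrix.mul_assoc X, ← h.trace_right, eVl, ← eVr, h.trace_right, Matrix.mul_assoc,
      trace_mul_comm V, Matrix.mul_assoc]
  have hY : W * Y = Y * W := by
    refine Matrix.ext_iff_trace_mul_right.mpr fun Z => mul_left_cancel₀ hμ' ?_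
    rw [Matrix.mul_assoc Y, ← h.trace_left, eWl, ← eWr, h.trace_left, Matrix.mul_assoc,
      trace_mul_comm W, Matrix.mul_assoc]
  refine ⟨hX, hY, ?_, ?_, fun Z => ?_, fun Z => ?_⟩
  · rw [IsHermitian, conjTranspose_mul, hV.1.eq, h.left_hermitian.eq, hX]
  · rw [IsHermitian, conjTranspose_mul, hW.1.eq, h.right_hermitian.eq, hY]
  · rw [eVl, ← eWr, h.trace_left, Matrix.mul_assoc, trace_mul_comm W, Matrix.mul_assoc]
  · rw [eWl, ← eVr, h.trace_right, Matrix.mul_assoc, trace_mul_comm V, Matrix.mul_assoc]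

end IsSingularPair

theorem trace_mul_of_orthonormal {ι : Type} [DecidableEq ι] {γ : ι → Mat k}
    (h : TraceOrthonormal γ) (hh : ∀ i, (γ i).IsHermitian) (i j : ι) :
    (γ i * γ j).trace = if i = j then 1 else 0 := by
  have := h i j
  rwa [(hh j).eq] at this

section Top

variable {s t : ℕ} {A : BiMat k m} {μ : ℝ} {ν : Fin t → ℝ}
  {γ : Fin s ⊕ Fin t → Mat k} {δ : Fin s ⊕ Fin t → Mat m}

/-- Singular pairs for the top singular value are combinations of the top Schmidt vectors. -/
theorem IsHermitianSchmidtDecomposition.isSingularPair_top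
    (h : IsHermitianSchmidtDecomposition A (Sum.elim (fun _ => μ) ν) γ δ) (x : Fin s → ℝ) :
    IsSingularPair A μ (∑ i, (x i : ℂ) • γ (Sum.inl i)) (∑ i, (x i : ℂ) • δ (Sum.inl i)) := by
  have hγ := trace_mul_of_orthonormal h.left_orthonormal h.left_hermitian
  have hδ := trace_mul_of_orthonormal h.right_orthonormal h.right_hermitian
  refine ⟨IsHermitian.sum _ fun i _ => (h.left_hermitian _).real_smul _,
    IsHermitian.sum _ fun i _ => (h.right_hermitian _).real_smul _, fun Z => ?_, fun Z => ?_⟩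
  · rw [h.eq_sum, trace_mul_smul_kronecker_sum]
    simp [Matrix.sum_mul, trace_sum, hγ, Finset.mul_sum]
  · rw [h.eq_sum, trace_mul_smul_kronecker_sum]
    simp [Matrix.sum_mul, trace_sum, hδ, Finset.mul_sum]
    exact Finset.sum_congr rfl fun i _ => by ring

theorem IsHermitianSchmidtDecomposition.eq_sum_of_isSingularPair
    (h : IsHermitianSchmidtDecomposition A (Sum.elim (fun _ => μ) ν) γ δ) (hμ : 0 < μ)
    (hν : ∀ j, ν j < μ) {X : Mat k} {Y : Mat m} (hXY : IsSingularPair A μ X Y) :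
    X = ∑ i, ((γ (Sum.inl i) * X).trace.re : ℂ) • γ (Sum.inl i) ∧
    Y = ∑ i, ((γ (Sum.inl i) * X).trace.re : ℂ) • δ (Sum.inl i) := by
  have hγ := trace_mul_of_orthonormal h.left_orthonormal h.left_hermitian
  have hδ := trace_mul_of_orthonormal h.right_orthonormal h.right_hermitian
  have hμ' : (μ : ℂ) ≠ 0 := Complex.ofReal_ne_zero.mpr hμ.ne'
  have e1 : ∀ i, ((Sum.elim (fun _ => μ) ν i : ℝ) : ℂ) * (γ i * X).trace = μ * (δ i * Y).trace := by
    intro i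
    have := hXY.trace_left (δ i)
    rw [h.eq_sum, trace_mul_smul_kronecker_sum] at this
    rw [trace_mul_comm (δ i), ← this]
    simp [hδ]
  have e2 : ∀ i, ((Sum.elim (fun _ => μ) ν i : ℝ) : ℂ) * (δ i * Y).trace = μ * (γ i * X).trace := by
    intro i
    have := hXY.trace_right (γ i)
    rw [h.eq_sum, trace_mul_smul_kronecker_sum] at this
    rw [trace_mul_comm (γ i), ← this]
    simp [hγ]
  have eγ : ∀ j, (γ (Sum.inr j) * X).trace = 0 ∧ (δ (Sum.inr j) * Y).trace = 0 := by
    intro j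
    have a1 := e1 (Sum.inr j)
    have a2 := e2 (Sum.inr j)
    simp only [Sum.elim_inr] at a1 a2
    have hν0 : 0 < ν j := h.pos (Sum.inr j)
    -- The two singular relations give ν² a = μ² a for a = tr(γ X), so components along smaller
    -- coefficients vanish.
    have hne : ((ν j : ℂ) ^ 2 - μ ^ 2) ≠ 0 := by
      norm_cast
      nlinarith [hν j]
    have a3 : ((ν j : ℂ) ^ 2 - μ ^ 2) * (γ (Sum.inr j) * X).trace = 0 := by
      linear_combination (ν j : ℂ) * a1 + μ * a2
    have a4 := (mul_eq_zero.mp a3).resolve_left hne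
    refine ⟨a4, ?_⟩
    rw [a4, mul_zero] at a1
    exact (mul_eq_zero.mp a1.symm).resolve_left hμ'
  have eδ : ∀ i, (δ (Sum.inl i) * Y).trace = (γ (Sum.inl i) * X).trace := fun i =>
    (mul_left_cancel₀ hμ' (e1 (Sum.inl i))).symm
  have hre : ∀ i, ((γ i * X).trace.re : ℂ) = (γ i * X).trace := fun i =>
    ((h.left_hermitian i).trace_mul_eq_re hXY.left_hermitian).symm
  simp only [hre]
  constructor
  · refine Matrix.ext_iff_trace_mul_right.mpr fun Z => mul_left_cancel₀ hμ' ?_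
    rw [← hXY.trace_right, h.eq_sum, trace_mul_smul_kronecker_sum]
    simp [Matrix.sum_mul, trace_sum, eγ, eδ, Finset.mul_sum]
    exact Finset.sum_congr rfl fun i _ => by ring
  · refine Matrix.ext_iff_trace_mul_right.mpr fun Z => mul_left_cancel₀ hμ' ?_
    rw [← hXY.trace_left, h.eq_sum, trace_mul_smul_kronecker_sum]
    simp [Matrix.sum_mul, trace_sum, eγ, Finset.mul_sum]

/-- Bessel's inequality with its defect; the equality case is what `IsSingularPair.posPart` needs.
-/
theorem trace_sub_sum_mul_self {ι : Type} [Fintype ι] [DecidableEq ι] {γ : ι → Mat k}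
    (h : TraceOrthonormal γ) (hh : ∀ i, (γ i).IsHermitian) {X : Mat k} (hX : X.IsHermitian) :
    ((X - ∑ i, ((γ i * X).trace.re : ℂ) • γ i) *
      (X - ∑ i, ((γ i * X).trace.re : ℂ) • γ i)).trace.re =
      (X * X).trace.re - ∑ i, (γ i * X).trace.re ^ 2 := by
  have hγ := trace_mul_of_orthonormal h hh
  obtain ⟨x, hx⟩ : ∃ x : ι → ℝ, ∀ i, (γ i * X).trace = x i :=
    ⟨_, fun i => (hh i).trace_mul_eq_re hX⟩
  simp only [hx, Complex.ofReal_re]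
  obtain ⟨S, hS⟩ : ∃ S, S = ∑ i, (x i : ℂ) • γ i := ⟨_, rfl⟩
  have h1 : (S * X).trace = ∑ i, (x i : ℂ) ^ 2 := by
    simp [hS, Matrix.sum_mul, trace_sum, hx, pow_two]
  have h2 : (S * S).trace = ∑ i, (x i : ℂ) ^ 2 := by
    have h3 : ∀ i, (γ i * S).trace = x i := fun i => by
      simp [hS, Matrix.mul_sum, trace_sum, hγ]
    conv_lhs => enter [1, 1]; rw [hS]
    simp [Matrix.sum_mul, trace_sum, h3, pow_two]
  rw [← hS]
  simp only [Matrix.sub_mul, Matrix.mul_sub, trace_sub, h2, h1, trace_mul_comm X S]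
  simp [← Complex.ofReal_pow]

theorem IsSingularPair.combination {X X' : Mat k} {Y Y' : Mat m} (h : IsSingularPair A μ X Y)
    (h' : IsSingularPair A μ X' Y') (a b : ℝ) :
    IsSingularPair A μ ((a : ℂ) • X + (b : ℂ) • X') ((a : ℂ) • Y + (b : ℂ) • Y') := by
  refine ⟨(h.left_hermitian.real_smul a).add (h'.left_hermitian.real_smul b),
    (h.right_hermitian.real_smul a).add (h'.right_hermitian.real_smul b), fun Z => ?_,
    fun Z => ?_⟩
  · simp only [add_kronecker, smul_kronecker, Matrix.mul_add, Matrix.mul_smul, Matrix.add_mul,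
      Matrix.smul_mul, trace_add, trace_smul, h.trace_left, h'.trace_left, smul_eq_mul]
    ring
  · simp only [kronecker_add, kronecker_smul, Matrix.mul_add, Matrix.mul_smul, Matrix.add_mul,
      Matrix.smul_mul, trace_add, trace_smul, h.trace_right, h'.trace_right, smul_eq_mul]
    ring

/-- Singular pairs for the top singular value are closed under taking positive parts. -/
theorem IsSingularPair.posPart (hA : A.PosSemidef)
    (h : IsHermitianSchmidtDecomposition A (Sum.elim (fun _ => μ) ν) γ δ) (hμ : 0 < μ)
    (hν : ∀ j, ν j < μ) {P N : Mat k} {Q R : Mat m} (hXY : IsSingularPair A μ (P - N) (Q - R))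
    (hP : P.PosSemidef) (hN : N.PosSemidef) (hQ : Q.PosSemidef) (hR : R.PosSemidef)
    (hPN : P * N = 0) (hQR : Q * R = 0) : IsSingularPair A μ P Q := by
  set c : Fin s ⊕ Fin t → ℝ := Sum.elim (fun _ => μ) ν with hc
  have hcμ : ∀ i, c i ≤ μ := by
    rintro (i | j)
    · exact le_rfl
    · exact (hν j).le
  have hNP : N * P = 0 := by
    rw [← hP.1.eq, ← hN.1.eq, ← conjTranspose_mul, hPN, conjTranspose_zero]
  have hRQ : R * Q = 0 := by
    rw [← hQ.1.eq, ← hR.1.eq, ← conjTranspose_mul, hQR, conjTranspose_zero]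
  -- As P N = 0, passing from P - N to P + N does not change the norm; the same holds for Q and R.
  have sX : (P + N) * (P + N) = (P - N) * (P - N) := by
    simp [Matrix.add_mul, Matrix.mul_add, Matrix.sub_mul, Matrix.mul_sub, hPN, hNP]
  have sY : (Q + R) * (Q + R) = (Q - R) * (Q - R) := by
    simp [Matrix.add_mul, Matrix.mul_add, Matrix.sub_mul, Matrix.mul_sub, hQR, hRQ]
  have e1 : (A * ((P - N) ⊗ₖ (Q - R))).trace = μ * ((Q + R) * (Q + R)).trace := by
    rw [sY, hXY.trace_left]
  have e2 : (A * ((P - N) ⊗ₖ (Q - R))).trace = μ * ((P + N) * (P + N)).trace := by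
    rw [sX, hXY.trace_right]
  have hX' := hP.1.add hN.1
  have hY' := hQ.1.add hR.1
  set X' := P + N with hX'def
  set Y' := Q + R with hY'def
  -- The form grows by twice the cross terms, which are nonnegative because `A` is positive
  -- semidefinite.
  have e3 : (A * (X' ⊗ₖ Y')).trace = (A * ((P - N) ⊗ₖ (Q - R))).trace +
      2 * ((A * (P ⊗ₖ R)).trace + (A * (N ⊗ₖ Q)).trace) := by
    simp only [X', Y', add_kronecker, kronecker_add, sub_kronecker, kronecker_sub, Matrix.mul_add,
      Matrix.mul_sub, trace_add, trace_sub]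
    ring
  have p1 := (Complex.le_def.mp (hA.trace_mul_nonneg (hP.kronecker hR))).1
  have p2 := (Complex.le_def.mp (hA.trace_mul_nonneg (hN.kronecker hQ))).1
  set x : Fin s ⊕ Fin t → ℝ := fun i => (γ i * X').trace.re with hx
  set y : Fin s ⊕ Fin t → ℝ := fun i => (δ i * Y').trace.re with hy
  have e4 : (A * (X' ⊗ₖ Y')).trace.re = ∑ i, c i * (x i * y i) := by
    rw [h.eq_sum, trace_mul_smul_kronecker_sum, Complex.re_sum]
    refine Finset.sum_congr rfl fun i _ => ?_
    rw [(h.left_hermitian i).trace_mul_eq_re hX', (h.right_hermitian i).trace_mul_eq_re hY',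
      ← Complex.ofReal_mul, ← Complex.ofReal_mul, Complex.ofReal_re]
  have bX := trace_sub_sum_mul_self h.left_orthonormal h.left_hermitian hX'
  have bY := trace_sub_sum_mul_self h.right_orthonormal h.right_hermitian hY'
  have hXs : (X' - ∑ i, (x i : ℂ) • γ i).IsHermitian :=
    hX'.sub (IsHermitian.sum _ fun i _ => (h.left_hermitian i).real_smul _)
  have hYs : (Y' - ∑ i, (y i : ℂ) • δ i).IsHermitian :=
    hY'.sub (IsHermitian.sum _ fun i _ => (h.right_hermitian i).real_smul _)
  have dX := hXs.trace_mul_self_nonneg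
  have dY := hYs.trace_mul_self_nonneg
  rw [bX] at dX
  rw [bY] at dY
  have r1 := congrArg Complex.re e1
  have r2 := congrArg Complex.re e2
  have r3 := congrArg Complex.re e3
  simp only [Complex.add_re, Complex.mul_re, Complex.ofReal_re, Complex.ofReal_im, zero_mul,
    sub_zero, Complex.re_ofNat, Complex.im_ofNat, Complex.zero_re] at r1 r2 r3 p1 p2
  -- The gap in c x y ≤ μ (x² + y²) / 2, doubled and written as a sum of nonnegative terms. With the
  -- two Bessel defects it must be 0, since the form at (X', Y') is at least μ ‖X'‖² = μ ‖Y'‖².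
  have hsum : ∑ i, ((μ - c i) * (x i ^ 2 + y i ^ 2) + c i * (x i - y i) ^ 2) =
      μ * ∑ i, x i ^ 2 + μ * ∑ i, y i ^ 2 - 2 * ∑ i, c i * (x i * y i) := by
    simp only [Finset.mul_sum, ← Finset.sum_add_distrib, ← Finset.sum_sub_distrib]
    exact Finset.sum_congr rfl fun i _ => by ring
  have hnn : ∀ i ∈ Finset.univ,
      0 ≤ (μ - c i) * (x i ^ 2 + y i ^ 2) + c i * (x i - y i) ^ 2 := fun i _ =>
    add_nonneg (mul_nonneg (sub_nonneg.mpr (hcμ i)) (by positivity))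
      (mul_nonneg (h.pos i).le (sq_nonneg _))
  have hs0 := Finset.sum_nonneg hnn
  have mX := mul_nonneg hμ.le dX
  have mY := mul_nonneg hμ.le dY
  rw [mul_sub] at mX mY
  have zsum : ∑ i, ((μ - c i) * (x i ^ 2 + y i ^ 2) + c i * (x i - y i) ^ 2) = 0 := by linarith
  have zX : (X' * X').trace.re - ∑ i, x i ^ 2 = 0 := by
    refine (mul_eq_zero.mp (?_ : μ * _ = 0)).resolve_left hμ.ne'
    rw [mul_sub]
    linarith
  have zY : (Y' * Y').trace.re - ∑ i, y i ^ 2 = 0 := by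
    refine (mul_eq_zero.mp (?_ : μ * _ = 0)).resolve_left hμ.ne'
    rw [mul_sub]
    linarith
  have fX := sub_eq_zero.mp (hXs.eq_zero_of_trace_mul_self (bX.trans zX))
  have fY := sub_eq_zero.mp (hYs.eq_zero_of_trace_mul_self (bY.trans zY))
  have zi := fun i => (Finset.sum_eq_zero_iff_of_nonneg hnn).mp zsum i (Finset.mem_univ i)
  have zl : ∀ i, y (Sum.inl i) = x (Sum.inl i) := by
    intro i
    have h1 := zi (Sum.inl i)
    simp only [hc, Sum.elim_inl, sub_self, zero_mul, zero_add] at h1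
    have h2 := pow_eq_zero_iff (two_ne_zero) |>.mp ((mul_eq_zero.mp h1).resolve_left hμ.ne')
    linarith
  have zr : ∀ j, x (Sum.inr j) = 0 ∧ y (Sum.inr j) = 0 := by
    intro j
    have h1 := zi (Sum.inr j)
    have h2 := (add_eq_zero_iff_of_nonneg (mul_nonneg (sub_nonneg.mpr (hcμ (Sum.inr j)))
      (by positivity)) (mul_nonneg (h.pos (Sum.inr j)).le (sq_nonneg _))).mp h1 |>.1
    have h3 := (mul_eq_zero.mp h2).resolve_left (sub_pos.mpr (hν j)).ne'
    have h4 := (add_eq_zero_iff_of_nonneg (sq_nonneg _) (sq_nonneg _)).mp h3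
    exact ⟨pow_eq_zero_iff two_ne_zero |>.mp h4.1, pow_eq_zero_iff two_ne_zero |>.mp h4.2⟩
  have hpair : IsSingularPair A μ X' Y' := by
    have := h.isSingularPair_top fun i => x (Sum.inl i)
    rw [fX, fY, Fintype.sum_sum_type, Fintype.sum_sum_type]
    simpa [zl, zr] using this
  -- P = ((P + N) + (P - N)) / 2, and likewise for Q.
  have hfin := hpair.combination hXY (1 / 2) (1 / 2)
  convert hfin using 1
  · ext i j
    simp [X']
    ring
  · ext i j
    simp [Y']
    ring

end Top

end SingularPair

/-! ### Real spaces of Hermitian matrices closed under positive parts -/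

section Lattice

variable {k : ℕ}

theorem Matrix.IsHermitian.mul_eq_zero_comm {X Y : Mat k} (hX : X.IsHermitian)
    (hY : Y.IsHermitian) (h : X * Y = 0) : Y * X = 0 := by
  rw [← hX.eq, ← hY.eq, ← conjTranspose_mul, h, conjTranspose_zero]

/-- A real space of Hermitian matrices that is closed under positive parts and compatible with the
support projections of its positive semidefinite members has a basis of positive semidefinite
matrices that annihilate each other. -/
theorem exists_posSemidef_orthogonal_span (E : Submodule ℝ (Mat k))
    (hparts : ∀ X ∈ E, ∃ P ∈ E, ∃ N ∈ E, P.PosSemidef ∧ N.PosSemidef ∧ X = P - N ∧ P * N = 0)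
    (hproj : ∀ X ∈ E, X.PosSemidef → ∃ V Z : Mat k, IsHermitianProjection V ∧ V * X = X ∧
      V = X * Z ∧ ∀ Y ∈ E, V * Y = Y * V ∧ V * Y ∈ E) :
    ∃ S : Finset (Mat k), (∀ X ∈ S, X.PosSemidef ∧ X ≠ 0) ∧
      (∀ X ∈ S, ∀ Y ∈ S, X ≠ Y → X * Y = 0) ∧ Submodule.span ℝ (S : Set (Mat k)) = E := by
  classical
  induction hd : Module.finrank ℝ E using Nat.strong_induction_on generalizing E with
  | _ d ih =>
  subst hd
  -- If all members are semidefinite, a member of trace 0 is 0, so the trace is injective on E and E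
  -- is at most a line. Otherwise some member has two nonzero parts P and N, and the support
  -- projection of P cuts E into two smaller spaces.
  by_cases hdef : ∀ X ∈ E, X.PosSemidef ∨ (-X).PosSemidef
  · by_cases hE : E = ⊥
    · exact ⟨∅, by simp, by simp, by simp [hE]⟩
    · obtain ⟨X, hXE, hX0⟩ := (Submodule.ne_bot_iff E).mp hE
      obtain ⟨X, hXE, hX0, hX⟩ : ∃ X ∈ E, X ≠ 0 ∧ X.PosSemidef := by
        rcases hdef X hXE with h | h
        · exact ⟨X, hXE, hX0, h⟩
        · exact ⟨-X, E.neg_mem hXE, neg_ne_zero.mpr hX0, h⟩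
      refine ⟨{X}, by simp [hX, hX0], by simp, le_antisymm ?_ ?_⟩
      · simpa using hXE
      · intro Y hY
        have htr : ∀ Z ∈ E, Z.trace.re = 0 → Z = 0 := by
          intro Z hZ h0
          have hreal : ∀ Z : Mat k, Z.PosSemidef → Z.trace.re = 0 → Z = 0 := fun Z hZ h0 =>
            hZ.trace_eq_zero_iff.mp (Complex.ext h0 (Complex.le_def.mp hZ.trace_nonneg).2.symm)
          rcases hdef Z hZ with h | h
          · exact hreal Z h h0
          · exact neg_eq_zero.mp (hreal _ h (by simp [h0]))
        have hXt : X.trace.re ≠ 0 := fun h => hX0 (htr X hXE h)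
        have h1 : Y - (Y.trace.re / X.trace.re) • X = 0 := by
          refine htr _ (E.sub_mem hY (E.smul_mem _ hXE)) ?_
          simp [trace_sub, trace_smul, hXt]
        rw [sub_eq_zero.mp h1]
        exact Submodule.smul_mem _ _ (Submodule.subset_span (by simp))
  · push Not at hdef
    obtain ⟨X, hXE, hX1, hX2⟩ := hdef
    obtain ⟨P, hPE, N, hNE, hP, hN, rfl, hPN⟩ := hparts X hXE
    have hP0 : P ≠ 0 := by
      rintro rfl
      exact hX2 (by simpa using hN)
    have hN0 : N ≠ 0 := by
      rintro rfl
      exact hX1 (by simpa using hP)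
    obtain ⟨V, Z, hV, hVP, hVZ, hVE⟩ := hproj P hPE hP
    have hVN : V * N = 0 := by
      have : N * V = 0 := by
        rw [hVZ, ← Matrix.mul_assoc, hP.1.mul_eq_zero_comm hN.1 hPN, Matrix.zero_mul]
      rw [(hVE N hNE).1, this]
    have hsub : ∀ V : Mat k, IsHermitianProjection V → (∀ Y ∈ E, V * Y = Y * V ∧ V * Y ∈ E) →
        (∃ Y ∈ E, V * Y ≠ Y) → ∃ S : Finset (Mat k), (∀ X ∈ S, X.PosSemidef ∧ X ≠ 0) ∧
          (∀ X ∈ S, ∀ Y ∈ S, X ≠ Y → X * Y = 0) ∧ (∀ X ∈ S, V * X = X) ∧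
          (∀ X ∈ S, X ∈ E) ∧ ∀ X ∈ E, V * X = X → X ∈ Submodule.span ℝ (S : Set (Mat k)) := by
      intro V hV hVE hne
      -- F is the part of E fixed by V. It inherits both closure properties because V commutes with
      -- E and preserves it.
      let F : Submodule ℝ (Mat k) := E ⊓ LinearMap.ker (LinearMap.mulLeft ℝ V - LinearMap.id)
      have hF : ∀ Y, Y ∈ F ↔ Y ∈ E ∧ V * Y = Y := fun Y => by
        simp [F, sub_eq_zero]
      have hlt : Module.finrank ℝ F < Module.finrank ℝ E := by
        refine Submodule.finrank_lt_finrank_of_lt (lt_of_le_of_ne inf_le_left fun h => ?_)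
        obtain ⟨Y, hY, hne⟩ := hne
        exact hne ((hF Y).mp (h ▸ hY)).2
      have hFparts : ∀ X ∈ F, ∃ P ∈ F, ∃ N ∈ F, P.PosSemidef ∧ N.PosSemidef ∧ X = P - N ∧
          P * N = 0 := by
        intro Y hY
        obtain ⟨hYE, hVY⟩ := (hF Y).mp hY
        obtain ⟨P, hPE, N, hNE, hP, hN, rfl, hPN⟩ := hparts Y hYE
        have hpsd : ∀ P ∈ E, P.PosSemidef → (V * P).PosSemidef := by
          intro P hPE hP
          have := hP.mul_mul_conjTranspose_same V
          rwa [hV.1.eq, Matrix.mul_assoc, ← (hVE P hPE).1, ← Matrix.mul_assoc, hV.2] at this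
        refine ⟨V * P, (hF _).mpr ⟨(hVE P hPE).2, by rw [← Matrix.mul_assoc, hV.2]⟩, V * N,
          (hF _).mpr ⟨(hVE N hNE).2, by rw [← Matrix.mul_assoc, hV.2]⟩, hpsd P hPE hP,
          hpsd N hNE hN, ?_, ?_⟩
        · rw [← Matrix.mul_sub, hVY]
        · rw [(hVE N hNE).1, ← Matrix.mul_assoc, Matrix.mul_assoc V, hPN]
          simp
      have hFproj : ∀ X ∈ F, X.PosSemidef → ∃ V Z : Mat k, IsHermitianProjection V ∧ V * X = X ∧
          V = X * Z ∧ ∀ Y ∈ F, V * Y = Y * V ∧ V * Y ∈ F := by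
        intro X hX hXp
        obtain ⟨hXE, hVX⟩ := (hF X).mp hX
        obtain ⟨U, Z, hU, hUX, hUZ, hUE⟩ := hproj X hXE hXp
        refine ⟨U, Z, hU, hUX, hUZ, fun Y hY => ?_⟩
        obtain ⟨hYE, hVY⟩ := (hF Y).mp hY
        refine ⟨(hUE Y hYE).1, (hF _).mpr ⟨(hUE Y hYE).2, ?_⟩⟩
        rw [(hUE Y hYE).1, ← Matrix.mul_assoc, hVY]
      obtain ⟨S, hS1, hS2, hS3⟩ := ih _ hlt F hFparts hFproj rfl
      have hSF : ∀ X ∈ S, X ∈ F := fun X hX => hS3 ▸ Submodule.subset_span hX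
      refine ⟨S, hS1, hS2, fun X hX => ((hF X).mp (hSF X hX)).2,
        fun X hX => ((hF X).mp (hSF X hX)).1, fun X hX hVX => ?_⟩
      rw [hS3]
      exact (hF X).mpr ⟨hX, hVX⟩
    -- N is killed by V and P by 1 - V, so neither part is all of E.
    obtain ⟨S, hS1, hS2, hS3, hS4, hS5⟩ := hsub V hV hVE ⟨N, hNE, by rw [hVN]; exact hN0.symm⟩
    obtain ⟨T, hT1, hT2, hT3, hT4, hT5⟩ := hsub (1 - V) hV.one_sub
      (fun Y hY => ⟨by rw [Matrix.sub_mul, Matrix.mul_sub, (hVE Y hY).1, Matrix.one_mul,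
        Matrix.mul_one], by
        rw [Matrix.sub_mul, Matrix.one_mul]
        exact E.sub_mem hY (hVE Y hY).2⟩)
      ⟨P, hPE, by rw [Matrix.sub_mul, hVP, Matrix.one_mul, sub_self]; exact hP0.symm⟩
    have hST : ∀ X ∈ S, ∀ Y ∈ T, X * Y = 0 := by
      intro X hX Y hY
      rw [← hS3 X hX, (hVE X (hS4 X hX)).1, ← hT3 Y hY, Matrix.mul_assoc, ← Matrix.mul_assoc V,
        Matrix.mul_sub, hV.2]
      simp
    refine ⟨S ∪ T, ?_, ?_, le_antisymm ?_ ?_⟩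
    · intro X hX
      rcases Finset.mem_union.mp hX with h | h
      · exact hS1 X h
      · exact hT1 X h
    · intro X hX Y hY hne
      rcases Finset.mem_union.mp hX with h | h <;> rcases Finset.mem_union.mp hY with h' | h'
      · exact hS2 X h Y h' hne
      · exact hST X h Y h'
      · exact (hS1 Y h').1.1.mul_eq_zero_comm (hT1 X h).1.1 (hST Y h' X h)
      · exact hT2 X h Y h' hne
    · rw [Submodule.span_le]
      intro X hX
      rcases Finset.mem_union.mp hX with h | h
      · exact hS4 X h
      · exact hT4 X h
    · intro X hX
      have h1 : X = V * X + (1 - V) * X := by rw [← Matrix.add_mul]; simp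
      rw [h1, Finset.coe_union, Submodule.span_union]
      refine Submodule.add_mem_sup (hS5 _ (hVE X hX).2 ?_) (hT5 _ ?_ ?_)
      · rw [← Matrix.mul_assoc, hV.2]
      · rw [Matrix.sub_mul, Matrix.one_mul]
        exact E.sub_mem hX (hVE X hX).2
      · rw [← Matrix.mul_assoc, hV.one_sub.2]

end Lattice

/-! ### Existence of Hermitian Schmidt decompositions -/

section Schmidt

/-- The spectral theorem, with the inner product passed as a core so that the norm it induces stays
local to the proof. -/
theorem exists_eigenbasis_of_core {F : Type*} [AddCommGroup F] [Module ℝ F]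
    [FiniteDimensional ℝ F] (cd : InnerProductSpace.Core ℝ F) (T : F →ₗ[ℝ] F)
    (hT : ∀ x y, cd.inner (T x) y = cd.inner x (T y)) :
    ∃ (n : ℕ) (u : Fin n → F) (e : Fin n → ℝ),
      (∀ i j, cd.inner (u i) (u j) = if i = j then 1 else 0) ∧ (∀ i, T (u i) = e i • u i) ∧
      ∀ x, x = ∑ i, cd.inner (u i) x • u i := by
  let _ : NormedAddCommGroup F := cd.toNormedAddCommGroup
  let _ : InnerProductSpace ℝ F := InnerProductSpace.ofCore cd.toCore
  have hsym : T.IsSymmetric := hT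
  let b := hsym.eigenvectorBasis rfl
  refine ⟨Module.finrank ℝ F, b, hsym.eigenvalues rfl, fun i j => ?_, fun i => ?_, fun x => ?_⟩
  · exact orthonormal_iff_ite.mp b.orthonormal i j
  · exact hsym.apply_eigenvectorBasis rfl i
  · exact (b.sum_repr' x).symm

variable {k m : ℕ}

theorem mem_selfAdjoint_submodule {X : Mat k} :
    X ∈ selfAdjoint.submodule ℝ (Mat k) ↔ X.IsHermitian := Iff.rfl

/-- The trace inner product on Hermitian matrices. -/
@[reducible]
noncomputable def hermitianInnerProductCore (k : ℕ) :
    InnerProductSpace.Core ℝ (selfAdjoint.submodule ℝ (Mat k)) where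
  inner X Y := ((X : Mat k) * (Y : Mat k)).trace.re
  conj_inner_symm X Y := by simp [trace_mul_comm (X : Mat k)]
  re_inner_nonneg X := IsHermitian.trace_mul_self_nonneg (mem_selfAdjoint_submodule.mp X.2)
  add_left X Y Z := by simp [Matrix.add_mul]
  smul_left X Y r := by simp
  definite X h := Subtype.ext
    (IsHermitian.eq_zero_of_trace_mul_self (mem_selfAdjoint_submodule.mp X.2) h)

/-- Diagonalisation of an operator that is symmetric on Hermitian matrices. -/
theorem exists_hermitian_eigenbasis (T : Mat k →ₗ[ℂ] Mat k)
    (hT : ∀ X, X.IsHermitian → (T X).IsHermitian)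
    (hsym : ∀ X Y, (T X * Y).trace = (T Y * X).trace) :
    ∃ (n : ℕ) (u : Fin n → Mat k) (e : Fin n → ℝ), (∀ i, (u i).IsHermitian) ∧
      TraceOrthonormal u ∧ (∀ i, T (u i) = (e i : ℂ) • u i) ∧
      ∀ X, X = ∑ i, (u i * X).trace • u i := by
  obtain ⟨n, u, e, h1, h2, h3⟩ := exists_eigenbasis_of_core (hermitianInnerProductCore k)
    ((T.restrictScalars ℝ).restrict (p := selfAdjoint.submodule ℝ (Mat k))
      (q := selfAdjoint.submodule ℝ (Mat k)) hT) (by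
        intro X Y
        change ((T X) * (Y : Mat k)).trace.re = ((X : Mat k) * (T Y)).trace.re
        rw [hsym, trace_mul_comm])
  have hu : ∀ i, (u i : Mat k).IsHermitian := fun i => mem_selfAdjoint_submodule.mp (u i).2
  have hX : ∀ X : Mat k, X.IsHermitian → X = ∑ i, ((u i : Mat k) * X).trace • (u i : Mat k) := by
    intro X hX
    have := congrArg Subtype.val (h3 ⟨X, hX⟩)
    simp only [AddSubmonoidClass.coe_finsetSum, Submodule.coe_smul] at this
    conv_lhs => rw [this]
    refine Finset.sum_congr rfl fun i _ => ?_
    rw [(hu i).trace_mul_eq_re hX]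
    rfl
  refine ⟨n, fun i => u i, e, hu, fun i j => ?_, fun i => ?_, fun X => ?_⟩
  · rw [(hu j).eq, (hu i).trace_mul_eq_re (hu j)]
    have := h1 i j
    change ((u i : Mat k) * (u j : Mat k)).trace.re = _ at this
    rw [this]
    split_ifs <;> simp
  · exact congrArg Subtype.val (h2 i)
  -- The expansion extends from Hermitian to all matrices, since both sides are complex linear.
  · have h4 := hX _ (realPart X).2
    have h5 := hX _ (imaginaryPart X).2
    conv_lhs => rw [← realPart_add_I_smul_imaginaryPart X, h4, h5]
    rw [Finset.smul_sum, ← Finset.sum_add_distrib]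
    refine Finset.sum_congr rfl fun i _ => ?_
    conv_rhs => rw [← realPart_add_I_smul_imaginaryPart X]
    rw [Matrix.mul_add, trace_add, Matrix.mul_smul, trace_smul, add_smul, smul_assoc]

theorem exists_left_contraction (A : BiMat k m) :
    ∃ G : Mat k →ₗ[ℂ] Mat m, ∀ X Y, (G X * Y).trace = (A * (X ⊗ₖ Y)).trace := by
  induction A using BiMat.kronecker_induction with
  | zero => exact ⟨0, by simp⟩
  | add A B hA hB =>
    obtain ⟨G, hG⟩ := hA
    obtain ⟨G', hG'⟩ := hB
    exact ⟨G + G', fun X Y => by simp [Matrix.add_mul, hG, hG']⟩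
  | kronecker P Q =>
    refine ⟨(traceLinearMap (Fin k) ℂ ℂ ∘ₗ LinearMap.mulLeft ℂ P).smulRight Q, fun X Y => ?_⟩
    simp [trace_kronecker_mul_kronecker]

theorem exists_right_contraction (A : BiMat k m) :
    ∃ F : Mat m →ₗ[ℂ] Mat k, ∀ X Y, (F Y * X).trace = (A * (X ⊗ₖ Y)).trace := by
  induction A using BiMat.kronecker_induction with
  | zero => exact ⟨0, by simp⟩
  | add A B hA hB =>
    obtain ⟨G, hG⟩ := hA
    obtain ⟨G', hG'⟩ := hB
    exact ⟨G + G', fun X Y => by simp [Matrix.add_mul, hG, hG']⟩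
  | kronecker P Q =>
    refine ⟨(traceLinearMap (Fin m) ℂ ℂ ∘ₗ LinearMap.mulLeft ℂ Q).smulRight P, fun X Y => ?_⟩
    simp [trace_kronecker_mul_kronecker, mul_comm]

theorem trace_mul_kronecker_conjTranspose {A : BiMat k m} (hA : A.IsHermitian) (X : Mat k)
    (Y : Mat m) : star (A * (X ⊗ₖ Y)).trace = (A * (Xᴴ ⊗ₖ Yᴴ)).trace := by
  rw [← trace_conjTranspose, conjTranspose_mul, conjTranspose_kronecker, hA.eq, trace_mul_comm]

theorem isHermitian_left_contraction {A : BiMat k m} (hA : A.IsHermitian)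
    {G : Mat k →ₗ[ℂ] Mat m} (hG : ∀ X Y, (G X * Y).trace = (A * (X ⊗ₖ Y)).trace) {X : Mat k}
    (hX : X.IsHermitian) : (G X).IsHermitian := by
  refine Matrix.ext_iff_trace_mul_right.mpr fun Y => ?_
  rw [hG, trace_mul_comm, ← conjTranspose_conjTranspose Y, ← conjTranspose_mul,
    trace_conjTranspose, hG, trace_mul_kronecker_conjTranspose hA, hX.eq]

theorem isHermitian_right_contraction {A : BiMat k m} (hA : A.IsHermitian)
    {F : Mat m →ₗ[ℂ] Mat k} (hF : ∀ X Y, (F Y * X).trace = (A * (X ⊗ₖ Y)).trace) {Y : Mat m}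
    (hY : Y.IsHermitian) : (F Y).IsHermitian := by
  refine Matrix.ext_iff_trace_mul_right.mpr fun X => ?_
  rw [hF, trace_mul_comm, ← conjTranspose_conjTranspose X, ← conjTranspose_mul,
    trace_conjTranspose, hF, trace_mul_kronecker_conjTranspose hA, hY.eq]

theorem eq_sum_kronecker_left_contraction {A : BiMat k m} {G : Mat k →ₗ[ℂ] Mat m}
    (hG : ∀ X Y, (G X * Y).trace = (A * (X ⊗ₖ Y)).trace) {n : ℕ} {u : Fin n → Mat k}
    (hu : ∀ X, X = ∑ i, (u i * X).trace • u i) : A = ∑ i, u i ⊗ₖ G (u i) := by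
  refine trace_mul_kronecker_ext fun X Y => ?_
  rw [← hG]
  conv_lhs => rw [hu X]
  simp [Matrix.sum_mul, trace_sum, trace_kronecker_mul_kronecker]

/-- Every Hermitian matrix has a Hermitian Schmidt decomposition. -/
theorem Matrix.IsHermitian.exists_schmidtDecomposition {A : BiMat k m} (hA : A.IsHermitian) :
    ∃ (ι : Type) (_ : Fintype ι) (_ : DecidableEq ι) (c : ι → ℝ) (γ : ι → Mat k) (δ : ι → Mat m),
      IsHermitianSchmidtDecomposition A c γ δ := by
  obtain ⟨G, hG⟩ := exists_left_contraction A
  obtain ⟨F, hF⟩ := exists_right_contraction A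
  have hGh : ∀ X : Mat k, X.IsHermitian → (G X).IsHermitian := fun X =>
    isHermitian_left_contraction hA hG
  have hFh : ∀ Y : Mat m, Y.IsHermitian → (F Y).IsHermitian := fun X =>
    isHermitian_right_contraction hA hF
  -- F is the transpose of G for the trace pairing, so F ∘ G is symmetric with eigenvalues ‖G(uᵢ)‖².
  -- What follows is the singular value decomposition of G.
  have hFG : ∀ X Y, (F (G X) * Y).trace = (G X * G Y).trace := fun X Y => by
    rw [hF, ← hG, trace_mul_comm]
  obtain ⟨n, u, e, hu, huo, hue, hux⟩ := exists_hermitian_eigenbasis (F ∘ₗ G)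
    (fun X hX => hFh _ (hGh X hX)) (fun X Y => by
      simp only [LinearMap.comp_apply]
      rw [hFG, hFG, trace_mul_comm])
  have hGo : ∀ i j, (G (u i) * G (u j)).trace = if i = j then (e i : ℂ) else 0 := by
    intro i j
    rw [← hFG, ← LinearMap.comp_apply, hue, Matrix.smul_mul, trace_smul,
      trace_mul_of_orthonormal huo hu]
    simp
  have he : ∀ i, 0 ≤ e i := by
    intro i
    have := (hGh _ (hu i)).trace_mul_self_nonneg
    rwa [hGo, if_pos rfl, Complex.ofReal_re] at this
  refine ⟨{i // e i ≠ 0}, inferInstance, inferInstance, fun i => √(e i), fun i => u i,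
    fun i => (((√(e i))⁻¹ : ℝ) : ℂ) • G (u i), ?_⟩
  have hpos : ∀ i : {i // e i ≠ 0}, 0 < √(e i) := fun i =>
    Real.sqrt_pos.mpr (lt_of_le_of_ne (he i) i.2.symm)
  have hδh : ∀ i : {i // e i ≠ 0}, ((((√(e i))⁻¹ : ℝ) : ℂ) • G (u i)).IsHermitian := fun i =>
    (hGh _ (hu i)).real_smul _
  refine ⟨hpos, fun i => hu i, hδh, fun i j => ?_, fun i j => ?_, ?_⟩
  · simpa [Subtype.ext_iff] using huo i j
  · rw [(hδh j).eq, Matrix.smul_mul, Matrix.mul_smul, trace_smul, trace_smul, hGo]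
    by_cases hij : i = j
    · subst hij
      have h1 : √(e i) * √(e i) = e i := Real.mul_self_sqrt (he i)
      simp only [if_true, smul_eq_mul]
      have h2 : (√(e i))⁻¹ * ((√(e i))⁻¹ * e i) = 1 := by
        rw [← mul_assoc, ← mul_inv, h1, inv_mul_cancel₀ i.2]
      exact_mod_cast h2
    · have : (i : Fin n) ≠ j := fun h => hij (Subtype.ext h)
      simp [hij, this]
  · conv_lhs => rw [eq_sum_kronecker_left_contraction hG hux,
      ← Fintype.sum_subtype_add_sum_subtype (fun i => e i ≠ 0)]
    have h0 : ∀ i : {i // ¬ e i ≠ 0}, u i ⊗ₖ G (u i) = 0 := by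
      rintro ⟨i, hi⟩
      have := (hGh _ (hu i)).eq_zero_of_trace_mul_self (by
        rw [hGo, if_pos rfl, not_not.mp hi]; rfl)
      simp [this]
    rw [Finset.sum_congr rfl fun i _ => h0 i, Finset.sum_const_zero, add_zero]
    refine Finset.sum_congr rfl fun i _ => ?_
    rw [kronecker_smul, smul_smul, ← Complex.ofReal_mul, mul_inv_cancel₀ (hpos i).ne',
      Complex.ofReal_one, one_smul]

/-- A combination with nonnegative coefficients of the squares `X ⊗ X` of Hermitian matrices has a
symmetric Hermitian Schmidt decomposition. -/
theorem exists_symmetric_schmidtDecomposition {ι : Type*} [Fintype ι] {c : ι → ℝ}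
    (hc : ∀ l, 0 ≤ c l) {X : ι → Mat k} (hX : ∀ l, (X l).IsHermitian) :
    ∃ (κ : Type) (_ : Fintype κ) (_ : DecidableEq κ) (e : κ → ℝ) (γ : κ → Mat k),
      IsHermitianSchmidtDecomposition (∑ l, (c l : ℂ) • (X l ⊗ₖ X l)) e γ γ := by
  obtain ⟨A, hA⟩ : ∃ A, A = ∑ l, (c l : ℂ) • (X l ⊗ₖ X l) := ⟨_, rfl⟩
  have hAh : A.IsHermitian := hA ▸ IsHermitian.sum _ fun l _ =>
    (isHermitian_kronecker (hX l) (hX l)).real_smul _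
  have htr : ∀ Y Z, (A * (Y ⊗ₖ Z)).trace = ∑ l, (c l : ℂ) * ((X l * Y).trace * (X l * Z).trace) :=
    fun Y Z => by rw [hA, trace_mul_smul_kronecker_sum]
  rw [← hA]
  obtain ⟨G, hG⟩ := exists_left_contraction A
  obtain ⟨n, u, e, hu, huo, hue, hux⟩ := exists_hermitian_eigenbasis G
    (fun X => isHermitian_left_contraction hAh hG) (fun Y Z => by
      rw [hG, hG, htr, htr]
      exact Finset.sum_congr rfl fun l _ => by ring)
  -- Here the contraction G itself is symmetric and nonnegative, so its own eigenvectors serve for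
  -- both factors.
  have he : ∀ i, 0 ≤ e i := by
    intro i
    have h1 : (e i : ℂ) = ∑ l, (c l : ℂ) * ((X l * u i).trace * (X l * u i).trace) := by
      rw [← htr, ← hG, hue, Matrix.smul_mul, trace_smul, trace_mul_of_orthonormal huo hu]
      simp
    have h2 : e i = ∑ l, c l * ((X l * u i).trace.re * (X l * u i).trace.re) := by
      rw [← Complex.ofReal_re (e i), h1, Complex.re_sum]
      refine Finset.sum_congr rfl fun l _ => ?_
      rw [(hX l).trace_mul_eq_re (hu i), ← Complex.ofReal_mul, ← Complex.ofReal_mul,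
        Complex.ofReal_re, Complex.ofReal_re]
    rw [h2]
    exact Finset.sum_nonneg fun l _ => mul_nonneg (hc l) (mul_self_nonneg _)
  refine ⟨{i // e i ≠ 0}, inferInstance, inferInstance, fun i => e i, fun i => u i,
    fun i => lt_of_le_of_ne (he i) i.2.symm, fun i => hu i, fun i => hu i, fun i j => ?_,
    fun i j => ?_, ?_⟩
  · simpa [Subtype.ext_iff] using huo i j
  · simpa [Subtype.ext_iff] using huo i j
  · conv_lhs => rw [eq_sum_kronecker_left_contraction hG hux,
      ← Fintype.sum_subtype_add_sum_subtype (fun i => e i ≠ 0)]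
    have h0 : ∀ i : {i // ¬ e i ≠ 0}, u i ⊗ₖ G (u i) = 0 := by
      rintro ⟨i, hi⟩
      rw [hue, not_not.mp hi]
      simp
    rw [Finset.sum_congr rfl fun i _ => h0 i, Finset.sum_const_zero, add_zero]
    refine Finset.sum_congr rfl fun i _ => ?_
    rw [hue, kronecker_smul]

theorem IsHermitianSchmidtDecomposition.reindex {ι κ : Type} [Fintype ι] [DecidableEq ι]
    [Fintype κ] [DecidableEq κ] {A : BiMat k m} {c : ι → ℝ} {γ : ι → Mat k} {δ : ι → Mat m}
    (h : IsHermitianSchmidtDecomposition A c γ δ) (f : κ ≃ ι) :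
    IsHermitianSchmidtDecomposition A (c ∘ f) (γ ∘ f) (δ ∘ f) := by
  refine ⟨fun i => h.pos _, fun i => h.left_hermitian _, fun i => h.right_hermitian _,
    fun i j => ?_, fun i j => ?_, ?_⟩
  · simpa using h.left_orthonormal (f i) (f j)
  · simpa using h.right_orthonormal (f i) (f j)
  · rw [h.eq_sum]
    exact (f.sum_comp fun i => (c i : ℂ) • (γ i ⊗ₖ δ i)).symm

/-- The terms of a Hermitian Schmidt decomposition can be listed with the largest coefficients
first. -/
theorem IsHermitianSchmidtDecomposition.exists_top {ι : Type} [Fintype ι] [DecidableEq ι]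
    {A : BiMat k m} {c : ι → ℝ} {γ : ι → Mat k} {δ : ι → Mat m}
    (h : IsHermitianSchmidtDecomposition A c γ δ) (hA : A ≠ 0) :
    ∃ (s t : ℕ) (μ : ℝ) (ν : Fin t → ℝ) (f : Fin s ⊕ Fin t ≃ ι), 1 ≤ s ∧ (∀ j, ν j < μ) ∧
      IsHermitianSchmidtDecomposition A (Sum.elim (fun _ => μ) ν) (γ ∘ f) (δ ∘ f) := by
  have : Nonempty ι := by
    by_contra hι
    rw [not_nonempty_iff] at hι
    exact hA (by rw [h.eq_sum]; simp)
  obtain ⟨i₀, hi₀⟩ := Finite.exists_max c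
  let p : ι → Prop := fun i => c i = c i₀
  let f : Fin (Fintype.card {i // p i}) ⊕ Fin (Fintype.card {i // ¬ p i}) ≃ ι :=
    (Equiv.sumCongr (Fintype.equivFin {i // p i}).symm
      (Fintype.equivFin {i // ¬ p i}).symm).trans (Equiv.sumCompl p)
  refine ⟨_, _, c i₀, fun j => c (f (Sum.inr j)), f, ?_, fun j => ?_, ?_⟩
  · exact Fintype.card_pos_iff.mpr ⟨⟨i₀, rfl⟩⟩
  · exact lt_of_le_of_ne (hi₀ _) ((Fintype.equivFin {i // ¬ p i}).symm j).2
  · convert h.reindex f using 1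
    ext i
    rcases i with i | j
    · exact ((Fintype.equivFin {i // p i}).symm i).2.symm
    · rfl

end Schmidt

/-! ### Split data: vanishing blocks, weak irreducibility, rank drop -/

section SplitData

variable {k m : ℕ}

theorem exists_eq_mul_of_range_subset {M N : Mat k}
    (h : Set.range M.mulVec ⊆ Set.range N.mulVec) : ∃ Z, M = N * Z := by
  choose z hz using fun j => h ⟨Pi.single j 1, rfl⟩
  refine ⟨Matrix.of fun i j => z j i, ?_⟩
  ext i j
  have := congrFun (hz j) i
  rw [mulVec_single_one] at this
  exact this.symm

theorem range_mulVec_mul_subset (M N : Mat k) :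
    Set.range (M * N).mulVec ⊆ Set.range M.mulVec := by
  rintro _ ⟨x, rfl⟩
  exact ⟨N.mulVec x, by rw [mulVec_mulVec]⟩

theorem isHermitianProjectionOnto_range {V ε Z : Mat k} (hV : IsHermitianProjection V)
    (h1 : V * ε = ε) (h2 : V = ε * Z) :
    IsHermitianProjectionOnto V (Set.range ε.mulVec) := by
  refine ⟨hV, Set.Subset.antisymm ?_ ?_⟩
  · rw [h2]
    exact range_mulVec_mul_subset _ _
  · rw [← h1]
    exact range_mulVec_mul_subset _ _

theorem IsHermitianProjectionOnto.factor {V ε : Mat k}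
    (h : IsHermitianProjectionOnto V (Set.range ε.mulVec)) : V * ε = ε ∧ ∃ Z, V = ε * Z := by
  obtain ⟨Z, hZ⟩ := exists_eq_mul_of_range_subset h.2.ge
  refine ⟨?_, exists_eq_mul_of_range_subset h.2.le⟩
  rw [hZ, ← Matrix.mul_assoc, h.1.2]

/-- A projection system consists of support projections and the complement of their sum. -/
theorem isProjectionSystem_iff {s : ℕ} {ε : Fin s → Mat k} (hε : ∀ i, (ε i).IsHermitian)
    (hε0 : ∀ i j, i ≠ j → ε i * ε j = 0) {V : Fin (s + 1) → Mat k} :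
    IsProjectionSystem ε V ↔
      (∀ i : Fin s, IsHermitianProjectionOnto (V i.castSucc) (Set.range (ε i).mulVec)) ∧
        V (Fin.last s) = 1 - ∑ i : Fin s, V i.castSucc := by
  refine and_congr_right fun h => ?_
  have hproj := fun i => (h i).1
  have hVε := fun i => (h i).factor.1
  have hεV : ∀ i, ε i * V i.castSucc = ε i := fun i => by
    rw [← (hε i).eq, ← (hproj i).1.eq, ← conjTranspose_mul, hVε]
  choose Z hZ using fun i => (h i).factor.2
  have hεV0 : ∀ i j, i ≠ j → ε i * V j.castSucc = 0 := fun i j hij => by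
    rw [hZ j, ← Matrix.mul_assoc, hε0 i j hij, Matrix.zero_mul]
  set Q := 1 - ∑ i : Fin s, V i.castSucc with hQ
  have hεQ : ∀ i, ε i * Q = 0 := fun i => by
    rw [hQ, Matrix.mul_sub, Matrix.mul_sum, Finset.sum_eq_single i
      (fun j _ hj => hεV0 i j hj.symm) (by simp), hεV, Matrix.mul_one, sub_self]
  have hQh : Q.IsHermitian := isHermitian_one.sub (IsHermitian.sum _ fun i _ => (hproj i).1)
  have hVQ : ∀ i : Fin s, V i.castSucc * Q = 0 := fun i => by
    rw [← (hproj i).1.eq, hZ i, conjTranspose_mul, (hε i).eq, Matrix.mul_assoc, hεQ,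
      Matrix.mul_zero]
  have hQQ : Q * Q = Q := by
    conv_lhs => enter [1]; rw [hQ]
    rw [Matrix.sub_mul, Matrix.sum_mul, Finset.sum_eq_zero fun i _ => hVQ i, sub_zero,
      Matrix.one_mul]
  have hmem : ∀ x : Fin k → ℂ, (∀ (i : Fin s) (y : Fin k → ℂ), star ((ε i).mulVec y) ⬝ᵥ x = 0) ↔
      ∀ i, (ε i).mulVec x = 0 := by
    refine fun x => forall_congr' fun i => ?_
    have : ∀ y, star ((ε i).mulVec y) ⬝ᵥ x = star y ⬝ᵥ (ε i).mulVec x := fun y => by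
      rw [star_mulVec, (hε i).eq, dotProduct_mulVec]
    simp only [this]
    exact ⟨fun h => dotProduct_star_self_eq_zero.mp (h ((ε i).mulVec x)),
      fun h y => by rw [h, dotProduct_zero]⟩
  constructor
  -- The two Hermitian projections have the same range, so each absorbs the other; taking adjoints
  -- makes them equal.
  · rintro ⟨hL, hLr⟩
    have h1 : ∀ i, ε i * V (Fin.last s) = 0 := by
      intro i
      refine ext_of_mulVec_single fun j => ?_
      have h2 : (V (Fin.last s)).mulVec (Pi.single j 1) ∈ Set.range (V (Fin.last s)).mulVec :=
        ⟨_, rfl⟩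
      rw [hLr] at h2
      rw [← mulVec_mulVec, (hmem _).mp h2 i, zero_mulVec]
    obtain ⟨T, hT⟩ : ∃ T, Q = V (Fin.last s) * T := by
      refine exists_eq_mul_of_range_subset ?_
      rw [hLr]
      rintro _ ⟨x, rfl⟩
      refine (hmem _).mpr fun i => ?_
      rw [mulVec_mulVec, hεQ, zero_mulVec]
    have h3 : V (Fin.last s) * Q = Q := by rw [hT, ← Matrix.mul_assoc, hL.2]
    have h4 : Q * V (Fin.last s) = V (Fin.last s) := by
      rw [hQ, Matrix.sub_mul, Matrix.sum_mul, Matrix.one_mul, Finset.sum_eq_zero, sub_zero]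
      intro i _
      rw [← (hproj i).1.eq, hZ i, conjTranspose_mul, (hε i).eq, Matrix.mul_assoc, h1,
        Matrix.mul_zero]
    rw [← h4, ← hQh.eq, ← hL.1.eq, ← conjTranspose_mul, h3]
  · intro hL
    rw [hL]
    refine ⟨⟨hQh, hQQ⟩, Set.ext fun x => ?_⟩
    rw [Set.mem_ofPred_eq, hmem]
    constructor
    · rintro ⟨y, rfl⟩ i
      rw [mulVec_mulVec, hεQ, zero_mulVec]
    · intro hx
      refine ⟨x, ?_⟩
      rw [hQ, sub_mulVec, one_mulVec, sum_mulVec, Finset.sum_eq_zero, sub_zero]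
      intro i _
      rw [← (hproj i).1.eq, hZ i, conjTranspose_mul, (hε i).eq, ← mulVec_mulVec, hx,
        mulVec_zero]

theorem IsProjectionSystem.resolution {s : ℕ} {ε : Fin s → Mat k} (hε : ∀ i, (ε i).IsHermitian)
    (hε0 : ∀ i j, i ≠ j → ε i * ε j = 0) {V : Fin (s + 1) → Mat k}
    (h : IsProjectionSystem ε V) :
    (∀ i, IsHermitianProjection (V i)) ∧ (∀ i j, i ≠ j → V i * V j = 0) ∧ ∑ i, V i = 1 ∧
      ∀ i, ε i * V (Fin.last s) = 0 := by
  have hL := ((isProjectionSystem_iff hε hε0).mp h).2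
  have hproj : ∀ i, IsHermitianProjection (V i) := by
    intro i
    induction i using Fin.lastCases with
    | last => exact h.2.1
    | cast i => exact (h.1 i).1
  have hVε := fun i => (h.1 i).factor.1
  have hεV : ∀ i, ε i * V i.castSucc = ε i := fun i => by
    rw [← (hε i).eq, ← (hproj _).1.eq, ← conjTranspose_mul, hVε]
  choose Z hZ using fun i => (h.1 i).factor.2
  have hεV0 : ∀ i j, i ≠ j → ε i * V j.castSucc = 0 := fun i j hij => by
    rw [hZ j, ← Matrix.mul_assoc, hε0 i j hij, Matrix.zero_mul]
  have hεL : ∀ i, ε i * V (Fin.last s) = 0 := fun i => by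
    rw [hL, Matrix.mul_sub, Matrix.mul_sum, Finset.sum_eq_single i
      (fun j _ hj => hεV0 i j hj.symm) (by simp), hεV, Matrix.mul_one, sub_self]
  have hstep : ∀ (i : Fin s) (M : Mat k), ε i * M = 0 → V i.castSucc * M = 0 := fun i M hM => by
    rw [← (hproj _).1.eq, hZ i, conjTranspose_mul, (hε i).eq, Matrix.mul_assoc, hM,
      Matrix.mul_zero]
  refine ⟨hproj, fun i j hij => ?_, ?_, hεL⟩
  · induction i using Fin.lastCases with
    | last =>
      induction j using Fin.lastCases with
      | last => exact absurd rfl hij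
      | cast j => exact (hproj _).mul_eq_zero_comm (hproj _) (hstep j _ (hεL j))
    | cast i =>
      induction j using Fin.lastCases with
      | last => exact hstep i _ (hεL i)
      | cast j => exact hstep i _ (hεV0 i j fun h => hij (h ▸ rfl))
  · rw [Fin.sum_univ_castSucc, hL]
    abel

theorem trace_compress_mul_kronecker (A : BiMat k m) (V X : Mat k) (W Y : Mat m) :
    (compress V W A * (X ⊗ₖ Y)).trace = (A * ((V * X * V) ⊗ₖ (W * Y * W))).trace := by
  rw [compress, Matrix.mul_assoc, Matrix.mul_assoc, trace_mul_comm]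
  simp only [Matrix.mul_assoc, ← mul_kronecker_mul]

namespace IsSplitData

variable {s t : ℕ} {A : BiMat k m} {μ : ℝ} {ν : Fin t → ℝ}
    {γ : Fin s ⊕ Fin t → Mat k} {δ : Fin s ⊕ Fin t → Mat m}
    {γ' : Fin s → Mat k} {δ' : Fin s → Mat m}
    {V : Fin (s + 1) → Mat k} {W : Fin (s + 1) → Mat m}

theorem pos (h : IsSplitData A μ ν γ δ γ' δ' V W) : 0 < μ :=
  h.schmidt.pos (Sum.inl ⟨0, h.one_le⟩)

/-- `A` is μ times the top sum plus terms in the remaining γ, δ. Pairing the two expressions of the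
top sum with those shows that they are orthogonal to every γ'ᵢ and δ'ᵢ. -/
theorem isSingularPair (h : IsSplitData A μ ν γ δ γ' δ' V W) (i : Fin s) :
    IsSingularPair A μ (γ' i) (δ' i) := by
  have hγ := trace_mul_of_orthonormal h.schmidt.left_orthonormal h.schmidt.left_hermitian
  have hδ := trace_mul_of_orthonormal h.schmidt.right_orthonormal h.schmidt.right_hermitian
  have hγ' := trace_mul_of_orthonormal h.schmidt_top.left_orthonormal h.schmidt_top.left_hermitian
  have hδ' := trace_mul_of_orthonormal h.schmidt_top.right_orthonormal
    h.schmidt_top.right_hermitian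
  have hD : ∀ X Y, ∑ j, (γ (Sum.inl j) * X).trace * (δ (Sum.inl j) * Y).trace =
      ∑ j, (γ' j * X).trace * (δ' j * Y).trace := by
    intro X Y
    have := congrArg (fun M => (M * (X ⊗ₖ Y)).trace) h.schmidt_top.eq_sum
    simpa [Matrix.sum_mul, trace_sum, trace_kronecker_mul_kronecker] using this
  have hA : ∀ X Y, (A * (X ⊗ₖ Y)).trace = μ * ∑ j, (γ' j * X).trace * (δ' j * Y).trace +
      ∑ j, (ν j : ℂ) * ((γ (Sum.inr j) * X).trace * (δ (Sum.inr j) * Y).trace) := by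
    intro X Y
    rw [← hD, h.schmidt.eq_sum, trace_mul_smul_kronecker_sum, Fintype.sum_sum_type,
      Finset.mul_sum]
    rfl
  have hγr : ∀ j, (γ (Sum.inr j) * γ' i).trace = 0 := by
    intro j
    have := hD (γ (Sum.inr j)) (δ' i)
    simp only [hγ, hδ'] at this
    rw [trace_mul_comm]
    simpa using this.symm
  have hδr : ∀ j, (δ (Sum.inr j) * δ' i).trace = 0 := by
    intro j
    have := hD (γ' i) (δ (Sum.inr j))
    simp only [hδ, hγ'] at this
    rw [trace_mul_comm]
    simpa using this.symm
  refine ⟨h.schmidt_top.left_hermitian i, h.schmidt_top.right_hermitian i, fun Z => ?_,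
    fun Z => ?_⟩
  · rw [hA]
    simp [hγ', hγr]
  · rw [hA]
    simp [hδ', hδr]

theorem left_mul_eq_zero (h : IsSplitData A μ ν γ δ γ' δ' V W) (i j : Fin s) (hij : i ≠ j) :
    γ' i * γ' j = 0 := by
  refine (h.left_posSemidef i).mul_eq_zero_of_trace_mul_eq_zero (h.left_posSemidef j) ?_
  rw [trace_mul_of_orthonormal h.schmidt_top.left_orthonormal h.schmidt_top.left_hermitian,
    if_neg hij]

theorem right_mul_eq_zero (h : IsSplitData A μ ν γ δ γ' δ' V W) (i j : Fin s) (hij : i ≠ j) :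
    δ' i * δ' j = 0 := by
  refine (h.right_posSemidef i).mul_eq_zero_of_trace_mul_eq_zero (h.right_posSemidef j) ?_
  rw [trace_mul_of_orthonormal h.schmidt_top.right_orthonormal h.schmidt_top.right_hermitian,
    if_neg hij]

/-- The mixed diagonal blocks of a positive semidefinite matrix vanish. -/
theorem mixed (h : IsSplitData A μ ν γ δ γ' δ' V W) (hA : A.PosSemidef) (i j : Fin (s + 1))
    (hij : i ≠ j) : A * (V i ⊗ₖ W j) = 0 := by
  obtain ⟨-, -, -, hγL⟩ := h.left_projections.resolution h.schmidt_top.left_hermitian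
    h.left_mul_eq_zero
  obtain ⟨-, -, -, hδL⟩ := h.right_projections.resolution h.schmidt_top.right_hermitian
    h.right_mul_eq_zero
  induction i using Fin.lastCases with
  | last =>
    induction j using Fin.lastCases with
    | last => exact absurd rfl hij
    | cast j =>
      obtain ⟨Z, hZ⟩ := (h.right_projections.1 j).factor.2
      have h0 : A * (V (Fin.last s) ⊗ₖ δ' j) = 0 := by
        refine mul_kronecker_eq_zero hA h.left_projections.2.1.posSemidef (h.right_posSemidef j) ?_
        rw [(h.isSingularPair j).trace_right, hγL, trace_zero, mul_zero]
      rw [hZ, ← Matrix.mul_one (V (Fin.last s)), mul_kronecker_mul, ← Matrix.mul_assoc, h0,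
        Matrix.zero_mul]
  | cast i =>
    obtain ⟨Z, hZ⟩ := (h.left_projections.1 i).factor.2
    -- Positivity gives the vanishing for γ'ᵢ first; it passes to V i because V i is γ'ᵢ times a
    -- matrix.
    have hstep : ∀ Y : Mat m, Y.PosSemidef → δ' i * Y = 0 → A * (V i.castSucc ⊗ₖ Y) = 0 := by
      intro Y hY hY0
      have h0 : A * (γ' i ⊗ₖ Y) = 0 := by
        refine mul_kronecker_eq_zero hA (h.left_posSemidef i) hY ?_
        rw [(h.isSingularPair i).trace_left, hY0, trace_zero, mul_zero]
      rw [hZ, ← Matrix.mul_one Y, mul_kronecker_mul, ← Matrix.mul_assoc, h0, Matrix.zero_mul]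
    induction j using Fin.lastCases with
    | last => exact hstep _ h.right_projections.2.1.posSemidef (hδL i)
    | cast j =>
      refine hstep _ (h.right_projections.1 j).1.posSemidef ?_
      obtain ⟨T, hT⟩ := (h.right_projections.1 j).factor.2
      rw [hT, ← Matrix.mul_assoc, h.right_mul_eq_zero i j fun e => hij (e ▸ rfl),
        Matrix.zero_mul]

theorem isBlockDecomposition (h : IsSplitData A μ ν γ δ γ' δ' V W) (hA : A.PosSemidef)
    (hoff : ∀ i j, i ≠ j → (V i ⊗ₖ W i) * A * (V j ⊗ₖ W j) = 0) :
    IsBlockDecomposition A V W := by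
  obtain ⟨hV1, hV2, hV3, -⟩ := h.left_projections.resolution h.schmidt_top.left_hermitian
    h.left_mul_eq_zero
  obtain ⟨hW1, hW2, hW3, -⟩ := h.right_projections.resolution h.schmidt_top.right_hermitian
    h.right_mul_eq_zero
  exact ⟨hV1, hW1, hV2, hW2, hV3, hW3, h.mixed hA, hoff⟩

/-- The trace of this block against γ'ᵢ ⊗ δ'ᵢ is μ > 0. -/
theorem compress_castSucc_ne_zero (h : IsSplitData A μ ν γ δ γ' δ' V W) (i : Fin s) :
    compress (V i.castSucc) (W i.castSucc) A ≠ 0 := by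
  intro h0
  have hV := (h.left_projections.1 i).factor.1
  have hW := (h.right_projections.1 i).factor.1
  have hV' : γ' i * V i.castSucc = γ' i := by
    rw [← (h.left_posSemidef i).1.eq, ← (h.left_projections.1 i).1.1.eq, ← conjTranspose_mul, hV]
  have hW' : δ' i * W i.castSucc = δ' i := by
    rw [← (h.right_posSemidef i).1.eq, ← (h.right_projections.1 i).1.1.eq, ← conjTranspose_mul,
      hW]
  have h1 := trace_compress_mul_kronecker A (V i.castSucc) (γ' i) (W i.castSucc) (δ' i)
  rw [h0, Matrix.zero_mul, trace_zero, hV, hW, hV', hW', (h.isSingularPair i).trace_left,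
    trace_mul_of_orthonormal h.schmidt_top.right_orthonormal h.schmidt_top.right_hermitian,
    if_pos rfl, mul_one] at h1
  exact h.pos.ne (by exact_mod_cast h1)

/-- A matrix with a simple largest Schmidt coefficient that is carried by the supports of the
corresponding positive semidefinite singular vectors is weak irreducible. -/
theorem isWeakIrreducible (h : IsSplitData A μ ν γ δ γ' δ' V W) (hA : A.PosSemidef) (a : Fin s)
    (ha : ∀ i, i = a) (hAa : A = compress (V a.castSucc) (W a.castSucc) A) :
    IsWeakIrreducible A := by
  refine ⟨hA, fun V₁ V₂ W₁ W₂ hV₁ hV₂ hW₁ hW₂ _ _ hV hW hA12 => ?_⟩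
  obtain rfl : V₂ = 1 - V₁ := eq_sub_of_add_eq' hV
  obtain rfl : W₂ = 1 - W₁ := eq_sub_of_add_eq' hW
  have hsum : ∀ {X Y}, IsSingularPair A μ X Y → ∃ x : ℂ, X = x • γ (Sum.inl a) := by
    intro X Y hXY
    refine ⟨((γ (Sum.inl a) * X).trace.re : ℂ),
      (h.schmidt.eq_sum_of_isSingularPair h.pos h.lt_top hXY).1.trans ?_⟩
    exact Finset.sum_eq_single a (fun b _ hb => absurd (ha b) hb) (by simp)
  obtain ⟨x, hx⟩ := hsum (h.isSingularPair a)
  -- V₁ γ' is again the left member of a top pair, and these form a line, so it is a multiple of γ';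
  -- V₁ being idempotent, so is the factor.
  obtain ⟨y, hy⟩ := hsum ((h.isSingularPair a).block h.pos.ne' hA.1 hV₁ hW₁ hA12).2.2
  have hγ0 : γ' a ≠ 0 := by
    intro h0
    have := trace_mul_of_orthonormal h.schmidt_top.left_orthonormal h.schmidt_top.left_hermitian
      a a
    simp [h0] at this
  have hx0 : x ≠ 0 := by
    rintro rfl
    exact hγ0 (by rw [hx, zero_smul])
  have hr : V₁ * γ' a = (y / x) • γ' a := by
    rw [hy, hx, smul_smul, div_mul_cancel₀ _ hx0]
  have hrr : (y / x) * (y / x) = y / x := by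
    refine smul_left_injective ℂ hγ0 ?_
    simp only
    rw [mul_smul, ← hr, ← Matrix.mul_smul, ← hr, ← Matrix.mul_assoc, hV₁.2]
  obtain ⟨Z, hZ⟩ := (h.left_projections.1 a).factor.2
  have hcomp : ∀ (U : Mat k) (U' : Mat m), U * γ' a = 0 → compress U U' A = 0 := by
    intro U U' hU
    rw [hAa, compress, compress, ← Matrix.mul_assoc, ← Matrix.mul_assoc, ← mul_kronecker_mul, hZ,
      ← Matrix.mul_assoc, hU]
    simp
  rcases IsIdempotentElem.iff_eq_zero_or_one.mp hrr with h0 | h1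
  · exact Or.inl (hcomp _ _ (by rw [hr, h0, zero_smul]))
  · exact Or.inr (hcomp _ _ (by rw [Matrix.sub_mul, hr, h1, one_smul, Matrix.one_mul, sub_self]))

/-- Some other block must be nonzero. For the last block any top one serves; for a top block, the
last one or another top one, unless neither exists, and then `A` would be weak irreducible. -/
theorem tensorRank_lt (h : IsSplitData A μ ν γ δ γ' δ' V W) (hA : A.PosSemidef)
    (hoff : ∀ i j, i ≠ j → (V i ⊗ₖ W i) * A * (V j ⊗ₖ W j) = 0) (hirr : ¬ IsWeakIrreducible A)
    (i : Fin (s + 1)) : tensorRank (compress (V i) (W i) A) < tensorRank A := by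
  have hB := h.isBlockDecomposition hA hoff
  induction i using Fin.lastCases with
  | last =>
    refine hB.tensorRank_lt (j := Fin.castSucc ⟨0, h.one_le⟩) ?_ (h.compress_castSucc_ne_zero _)
    exact (Fin.castSucc_lt_last _).ne'
  | cast a =>
    by_cases hL : compress (V (Fin.last s)) (W (Fin.last s)) A = 0
    · by_cases ha : ∀ i, i = a
      · refine absurd (h.isWeakIrreducible hA a ha ?_) hirr
        conv_lhs => rw [hB.eq_sum hA.1]
        rw [Fin.sum_univ_castSucc, hL, add_zero]
        exact Finset.sum_eq_single a (fun b _ hb => absurd (ha b) hb) (by simp)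
      · push Not at ha
        obtain ⟨b, hb⟩ := ha
        exact hB.tensorRank_lt (fun e => hb (Fin.castSucc_injective _ e).symm)
          (h.compress_castSucc_ne_zero b)
    · exact hB.tensorRank_lt (Fin.castSucc_lt_last _).ne hL

end IsSplitData

end SplitData

/-! ### Existence of split decompositions -/

section Existence

variable {k m : ℕ}

theorem Matrix.PosSemidef.real_smul {X : Mat k} (hX : X.PosSemidef) {r : ℝ} (hr : 0 ≤ r) :
    ((r : ℂ) • X).PosSemidef :=
  hX.smul (Complex.zero_le_real.mpr hr)

theorem linearIndependent_of_mul_eq_zero {ι : Type*} {X : ι → Mat k}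
    (hX : ∀ a, (X a).IsHermitian) (h0 : ∀ a, X a ≠ 0) (horth : ∀ a b, a ≠ b → X a * X b = 0) :
    LinearIndependent ℝ X := by
  classical
  refine linearIndependent_iff'.mpr fun S g hg a ha => ?_
  have h1 := congrArg (fun M => X a * M) hg
  simp only [Matrix.mul_sum, Matrix.mul_smul, Matrix.mul_zero] at h1
  rw [Finset.sum_eq_single a (fun b _ hb => by rw [horth a b hb.symm, smul_zero])
    (fun h => absurd ha h)] at h1
  refine (smul_eq_zero.mp h1).resolve_right fun h2 => h0 a ?_
  exact (hX a).eq_zero_of_trace_mul_self (by rw [h2]; simp)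

theorem linearIndependent_of_traceOrthonormal {ι : Type} [DecidableEq ι] {γ : ι → Mat k}
    (h : TraceOrthonormal γ) : LinearIndependent ℝ γ := by
  refine linearIndependent_iff'.mpr fun S g hg a ha => ?_
  have h1 := congrArg (fun M => (M * (γ a)ᴴ).trace.re) hg
  simpa [Matrix.sum_mul, trace_sum, h _ a, ha, apply_ite] using h1

section

variable {s t : ℕ} {A : BiMat k m} {μ : ℝ} {ν : Fin t → ℝ}
  {γ : Fin s ⊕ Fin t → Mat k} {δ : Fin s ⊕ Fin t → Mat m}

theorem IsHermitianSchmidtDecomposition.mem_span_top_iff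
    (h : IsHermitianSchmidtDecomposition A (Sum.elim (fun _ => μ) ν) γ δ) (hμ : 0 < μ)
    (hν : ∀ j, ν j < μ) {X : Mat k} :
    X ∈ Submodule.span ℝ (Set.range (γ ∘ Sum.inl)) ↔ ∃ Y, IsSingularPair A μ X Y := by
  constructor
  · intro hX
    obtain ⟨x, rfl⟩ := (Submodule.mem_span_range_iff_exists_fun ℝ).mp hX
    exact ⟨_, by simpa only [Complex.coe_smul, Function.comp_apply] using h.isSingularPair_top x⟩
  · rintro ⟨Y, hXY⟩
    rw [(h.eq_sum_of_isSingularPair hμ hν hXY).1]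
    refine Submodule.sum_mem _ fun i _ => ?_
    rw [Complex.coe_smul]
    exact Submodule.smul_mem _ _ (Submodule.subset_span ⟨i, rfl⟩)

/-- With N = 0, `IsSingularPair.posPart` makes the positive part of Y a partner of X as well, and
partners are unique. -/
theorem IsSingularPair.right_posSemidef (hA : A.PosSemidef)
    (h : IsHermitianSchmidtDecomposition A (Sum.elim (fun _ => μ) ν) γ δ) (hμ : 0 < μ)
    (hν : ∀ j, ν j < μ) {X : Mat k} {Y : Mat m} (hXY : IsSingularPair A μ X Y)
    (hX : X.PosSemidef) : Y.PosSemidef := by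
  obtain ⟨Q, R, hQ, hR, rfl, hQR⟩ := hXY.right_hermitian.exists_posSemidef_sub
  have h1 : IsSingularPair A μ X Q := by
    rw [← sub_zero X] at hXY
    exact hXY.posPart hA h hμ hν hX PosSemidef.zero hQ hR (Matrix.mul_zero _) hQR
  rwa [hXY.right_unique hμ.ne' h1]

/-- The top part of a Hermitian Schmidt decomposition can be rewritten with positive semidefinite
factors, provided that `A` splits along the supports of its positive semidefinite top singular
pairs. -/
theorem IsHermitianSchmidtDecomposition.exists_posSemidef_top (hA : A.PosSemidef)
    (h : IsHermitianSchmidtDecomposition A (Sum.elim (fun _ => μ) ν) γ δ) (hμ : 0 < μ)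
    (hν : ∀ j, ν j < μ)
    (hred : ∀ (X : Mat k) (Y : Mat m), X.PosSemidef → Y.PosSemidef → IsSingularPair A μ X Y →
      ∃ (V Z : Mat k) (W : Mat m), IsHermitianProjection V ∧ IsHermitianProjection W ∧
        V * X = X ∧ V = X * Z ∧ A = compress V W A + compress (1 - V) (1 - W) A) :
    ∃ (γ' : Fin s → Mat k) (δ' : Fin s → Mat m),
      IsHermitianSchmidtDecomposition (∑ i : Fin s, γ (Sum.inl i) ⊗ₖ δ (Sum.inl i))
        (fun _ => 1) γ' δ' ∧
      (∀ i, (γ' i).PosSemidef) ∧ (∀ i, (δ' i).PosSemidef) ∧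
      ∀ i, IsSingularPair A μ (γ' i) (δ' i) := by
  classical
  obtain ⟨E, hE⟩ : ∃ E, E = Submodule.span ℝ (Set.range (γ ∘ Sum.inl)) := ⟨_, rfl⟩
  have hmem : ∀ X, X ∈ E ↔ ∃ Y, IsSingularPair A μ X Y := fun X => by
    rw [hE]
    exact h.mem_span_top_iff hμ hν
  obtain ⟨S, hS1, hS2, hS3⟩ := exists_posSemidef_orthogonal_span E
    (by
      intro X hX
      obtain ⟨Y, hXY⟩ := (hmem X).mp hX
      obtain ⟨P, N, hP, hN, rfl, hPN⟩ := hXY.left_hermitian.exists_posSemidef_sub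
      obtain ⟨Q, R, hQ, hR, rfl, hQR⟩ := hXY.right_hermitian.exists_posSemidef_sub
      have hPE : P ∈ E := (hmem P).mpr ⟨Q, hXY.posPart hA h hμ hν hP hN hQ hR hPN hQR⟩
      exact ⟨P, hPE, N, by simpa using E.sub_mem hPE hX, hP, hN, rfl, hPN⟩)
    (by
      intro X hX hXp
      obtain ⟨Y, hXY⟩ := (hmem X).mp hX
      obtain ⟨V, Z, W, hV, hW, hVX, hVZ, hAVW⟩ := hred X Y hXp
        (hXY.right_posSemidef hA h hμ hν hXp) hXY
      refine ⟨V, Z, hV, hVX, hVZ, fun X' hX' => ?_⟩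
      obtain ⟨Y', hXY'⟩ := (hmem X').mp hX'
      have := hXY'.block hμ.ne' hA.1 hV hW hAVW
      exact ⟨this.1, (hmem _).mpr ⟨_, this.2.2⟩⟩)
  -- The annihilating family and the top γ are both bases of E, so the number of new factors is
  -- again s.
  have hcard : Fintype.card S = s := by
    have h1 : Module.finrank ℝ E = s := by
      rw [hE, finrank_span_eq_card, Fintype.card_fin]
      exact (linearIndependent_of_traceOrthonormal h.left_orthonormal).comp _ Sum.inl_injective
    have h2 : LinearIndependent ℝ (fun X : S => (X : Mat k)) :=
      linearIndependent_of_mul_eq_zero (fun X => (hS1 X X.2).1.1) (fun X => (hS1 X X.2).2)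
        fun X Y hXY => hS2 X X.2 Y Y.2 fun e => hXY (Subtype.ext e)
    have h3 := finrank_span_eq_card h2
    rw [Subtype.range_coe_subtype] at h3
    have h4 : {x | x ∈ S} = (S : Set (Mat k)) := rfl
    rw [h4, hS3, h1] at h3
    exact h3.symm
  let f : Fin s ≃ S := (Fintype.equivFinOfCardEq hcard).symm
  have hr : ∀ i, 0 < ((f i : Mat k) * (f i : Mat k)).trace.re := fun i =>
    lt_of_le_of_ne (hS1 _ (f i).2).1.1.trace_mul_self_nonneg fun h0 =>
      (hS1 _ (f i).2).2 ((hS1 _ (f i).2).1.1.eq_zero_of_trace_mul_self h0.symm)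
  obtain ⟨r, hrdef⟩ : ∃ r : Fin s → ℝ, r = fun i =>
    (√((f i : Mat k) * (f i : Mat k)).trace.re)⁻¹ := ⟨_, rfl⟩
  have hr0 : ∀ i, 0 < r i := fun i => by
    rw [hrdef]
    exact inv_pos.mpr (Real.sqrt_pos.mpr (hr i))
  obtain ⟨γ', hγ'def⟩ : ∃ γ' : Fin s → Mat k, γ' = fun i => (r i : ℂ) • (f i : Mat k) := ⟨_, rfl⟩
  have hγ'p : ∀ i, (γ' i).PosSemidef := fun i => by
    rw [hγ'def]
    exact (hS1 _ (f i).2).1.real_smul (hr0 i).le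
  have hγ'o : ∀ i j, (γ' i * γ' j).trace = if i = j then 1 else 0 := by
    intro i j
    simp only [hγ'def, Matrix.smul_mul, Matrix.mul_smul, trace_smul]
    split_ifs with hij
    · subst hij
      rw [(hS1 _ (f i).2).1.1.trace_mul_eq_re (hS1 _ (f i).2).1.1, hrdef]
      simp only [smul_eq_mul]
      have : (√((f i : Mat k) * (f i : Mat k)).trace.re)⁻¹ *
          ((√((f i : Mat k) * (f i : Mat k)).trace.re)⁻¹ *
            ((f i : Mat k) * (f i : Mat k)).trace.re) = 1 := by
        rw [← mul_assoc, ← mul_inv, Real.mul_self_sqrt (hr i).le, inv_mul_cancel₀ (hr i).ne']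
      exact_mod_cast this
    · rw [hS2 _ (f i).2 _ (f j).2 fun e => hij (f.injective (Subtype.ext e))]
      simp
  have hspan : Submodule.span ℝ (Set.range γ') = E := by
    rw [← hS3]
    refine le_antisymm (Submodule.span_le.mpr ?_) (Submodule.span_le.mpr ?_)
    · rintro _ ⟨i, rfl⟩
      rw [hγ'def, SetLike.mem_coe]
      simp only [Complex.coe_smul]
      exact Submodule.smul_mem _ _ (Submodule.subset_span (f i).2)
    · intro X hX
      have h1 : X = (r (f.symm ⟨X, hX⟩))⁻¹ • γ' (f.symm ⟨X, hX⟩) := by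
        simp only [hγ'def, Complex.coe_smul, Equiv.apply_symm_apply]
        rw [smul_smul, inv_mul_cancel₀ (hr0 _).ne', one_smul]
      rw [SetLike.mem_coe, h1]
      exact Submodule.smul_mem _ _ (Submodule.subset_span ⟨_, rfl⟩)
  have hγ'E : ∀ i, γ' i ∈ E := fun i => hspan ▸ Submodule.subset_span ⟨i, rfl⟩
  choose δ' hδ' using fun i => (hmem _).mp (hγ'E i)
  obtain ⟨x, hx⟩ : ∃ x : Fin s → Fin s → ℝ, ∀ a i, (γ (Sum.inl i) * γ' a).trace = x a i :=
    ⟨_, fun a i => (h.left_hermitian _).trace_mul_eq_re (hγ'p a).1⟩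
  have hγ'x : ∀ a, γ' a = ∑ i, (x a i : ℂ) • γ (Sum.inl i) := fun a => by
    have := (h.eq_sum_of_isSingularPair hμ hν (hδ' a)).1
    simpa only [hx, Complex.ofReal_re] using this
  have hδ'x : ∀ a, δ' a = ∑ i, (x a i : ℂ) • δ (Sum.inl i) := fun a => by
    have := (h.eq_sum_of_isSingularPair hμ hν (hδ' a)).2
    simpa only [hx, Complex.ofReal_re] using this
  have hγx : ∀ i, γ (Sum.inl i) = ∑ a, (x a i : ℂ) • γ' a := by
    intro i
    have h1 : γ (Sum.inl i) ∈ Submodule.span ℝ (Set.range γ') := by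
      rw [hspan, hE]
      exact Submodule.subset_span ⟨i, rfl⟩
    obtain ⟨y, hy⟩ := (Submodule.mem_span_range_iff_exists_fun ℝ).mp h1
    have h2 : ∀ a, x a i = y a := by
      intro a
      have h3 := hx a i
      rw [← hy] at h3
      simp only [← Complex.coe_smul, Matrix.sum_mul, trace_sum, Matrix.smul_mul, trace_smul,
        hγ'o] at h3
      simpa using h3.symm
    simp only [h2, Complex.coe_smul, hy]
  have hδo := trace_mul_of_orthonormal h.right_orthonormal h.right_hermitian
  -- The change of basis x is real orthogonal. As δ' arises from δ by the same x, orthonormality of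
  -- δ' and equality of the two top sums follow.
  have hxx : ∀ a b, ∑ i, (x a i : ℂ) * (x b i : ℂ) = if a = b then 1 else 0 := by
    intro a b
    rw [← hγ'o]
    conv_rhs => rw [hγ'x a]
    simp [Matrix.sum_mul, trace_sum, hx]
  refine ⟨γ', δ', ⟨fun _ => one_pos, fun i => (hγ'p i).1, fun i => (hδ' i).right_hermitian,
    fun i j => ?_, fun i j => ?_, ?_⟩, hγ'p,
    fun i => (hδ' i).right_posSemidef hA h hμ hν (hγ'p i), hδ'⟩
  · rw [(hγ'p j).1.eq, hγ'o]
  · rw [(hδ' j).right_hermitian.eq, ← hxx, hδ'x i, hδ'x j]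
    simp [Matrix.sum_mul, Matrix.mul_sum, trace_sum, hδo, mul_comm]
  · simp only [Complex.ofReal_one, one_smul, hδ'x, kronecker_sum, kronecker_smul]
    rw [Finset.sum_comm]
    refine Finset.sum_congr rfl fun i _ => ?_
    conv_lhs => rw [hγx i, sum_kronecker]
    exact Finset.sum_congr rfl fun a _ => smul_kronecker _ _ _

end

theorem exists_isProjectionSystem {s : ℕ} {ε : Fin s → Mat k} (hε : ∀ i, (ε i).IsHermitian)
    (hε0 : ∀ i j, i ≠ j → ε i * ε j = 0) : ∃ V : Fin (s + 1) → Mat k, IsProjectionSystem ε V := by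
  choose V Z hV1 hV2 hV3 hV4 using fun i => (hε i).exists_support_projection
  refine ⟨Fin.snoc V (1 - ∑ i, V i), (isProjectionSystem_iff hε hε0).mpr ⟨fun i => ?_, ?_⟩⟩
  · rw [Fin.snoc_castSucc]
    exact isHermitianProjectionOnto_range ⟨hV1 i, hV2 i⟩ (hV3 i) (hV4 i)
  · simp only [Fin.snoc_last, Fin.snoc_castSucc]

/-- A matrix splits along the supports of a positive semidefinite singular pair if its off-diagonal
blocks vanish. -/
theorem IsSingularPair.eq_compress_add_compress {A : BiMat k m} {μ : ℝ} {X : Mat k} {Y : Mat m}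
    (h : IsSingularPair A μ X Y) (hA : A.PosSemidef) (hX : X.PosSemidef) (hY : Y.PosSemidef)
    {V Z : Mat k} {W T : Mat m} (hV : IsHermitianProjection V) (hW : IsHermitianProjection W)
    (hVX : V * X = X) (hVZ : V = X * Z) (hWY : W * Y = Y) (hWT : W = Y * T)
    (hoff : A * (V ⊗ₖ (1 - W)) = 0 → A * ((1 - V) ⊗ₖ W) = 0 →
      (V ⊗ₖ W) * A * ((1 - V) ⊗ₖ (1 - W)) = 0) :
    A = compress V W A + compress (1 - V) (1 - W) A := by
  have h1 : A * (V ⊗ₖ (1 - W)) = 0 := by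
    have h0 : A * (X ⊗ₖ (1 - W)) = 0 := by
      refine mul_kronecker_eq_zero hA hX hW.one_sub.posSemidef ?_
      have hYW : Y * W = Y := by rw [← hY.1.eq, ← hW.1.eq, ← conjTranspose_mul, hWY]
      rw [h.trace_left, Matrix.mul_sub, hYW, Matrix.mul_one, sub_self, trace_zero, mul_zero]
    rw [hVZ, ← Matrix.mul_one (1 - W), mul_kronecker_mul, ← Matrix.mul_assoc, h0, Matrix.zero_mul]
  have h2 : A * ((1 - V) ⊗ₖ W) = 0 := by
    have h0 : A * ((1 - V) ⊗ₖ Y) = 0 := by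
      refine mul_kronecker_eq_zero hA hV.one_sub.posSemidef hY ?_
      have hXV : X * V = X := by rw [← hX.1.eq, ← hV.1.eq, ← conjTranspose_mul, hVX]
      rw [h.trace_right, Matrix.mul_sub, hXV, Matrix.mul_one, sub_self, trace_zero, mul_zero]
    rw [hWT, ← Matrix.mul_one (1 - V), mul_kronecker_mul, ← Matrix.mul_assoc, h0, Matrix.zero_mul]
  have h3 := hoff h1 h2
  have h4 : ((1 - V) ⊗ₖ (1 - W)) * A * (V ⊗ₖ W) = 0 := by
    have := congrArg conjTranspose h3
    rwa [conjTranspose_mul, conjTranspose_mul, hA.1.eq,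
      (isHermitian_kronecker hV.1 hW.1).eq,
      (isHermitian_kronecker hV.one_sub.1 hW.one_sub.1).eq, conjTranspose_zero,
      ← Matrix.mul_assoc] at this
  have hVV : V * (1 - V) = 0 := by rw [Matrix.mul_sub, hV.2, Matrix.mul_one, sub_self]
  have hWW : W * (1 - W) = 0 := by rw [Matrix.mul_sub, hW.2, Matrix.mul_one, sub_self]
  have hB : IsBlockDecomposition A ![V, 1 - V] ![W, 1 - W] := by
    refine ⟨?_, ?_, ?_, ?_, by simp, by simp, ?_, ?_⟩ <;>
      simp only [Fin.forall_fin_two, Matrix.cons_val_zero, Matrix.cons_val_one, ne_eq,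
        not_true_eq_false, false_imp_iff, true_and, and_true, zero_ne_one, one_ne_zero,
        not_false_eq_true, true_imp_iff]
    · exact ⟨hV, hV.one_sub⟩
    · exact ⟨hW, hW.one_sub⟩
    · exact ⟨hVV, hV.mul_eq_zero_comm hV.one_sub hVV⟩
    · exact ⟨hWW, hW.mul_eq_zero_comm hW.one_sub hWW⟩
    · exact ⟨h1, h2⟩
    · exact ⟨h3, h4⟩
  simpa using hB.eq_sum hA.1

theorem IsPPT.exists_splitDecomposition {A : BiMat k m} (hA : IsPPT A) (hA0 : A ≠ 0) :
    ∃ (s : ℕ) (T : Fin (s + 1) → BiMat k m), IsPPTSplitDecomposition s A T := by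
  obtain ⟨ι, _, _, c, γ, δ, h⟩ := hA.1.1.exists_schmidtDecomposition
  obtain ⟨s, t, μ, ν, f, hs, hν, h⟩ := h.exists_top hA0
  have hμ : 0 < μ := h.pos (Sum.inl ⟨0, hs⟩)
  obtain ⟨γ', δ', htop, hγ', hδ', -⟩ := h.exists_posSemidef_top hA.1 hμ hν (by
    intro X Y hX hY hXY
    obtain ⟨V, Z, hV1, hV2, hV3, hV4⟩ := hX.1.exists_support_projection
    obtain ⟨W, T, hW1, hW2, hW3, hW4⟩ := hY.1.exists_support_projection
    exact ⟨V, Z, W, ⟨hV1, hV2⟩, ⟨hW1, hW2⟩, hV3, hV4, hXY.eq_compress_add_compress hA.1 hX hY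
      ⟨hV1, hV2⟩ ⟨hW1, hW2⟩ hV3 hV4 hW3 hW4 fun h1 _ => hA.off_diagonal_eq_zero ⟨hV1, hV2⟩
        (IsHermitianProjection.one_sub ⟨hW1, hW2⟩) h1⟩)
  have hl : ∀ i j, i ≠ j → γ' i * γ' j = 0 := fun i j hij =>
    (hγ' i).mul_eq_zero_of_trace_mul_eq_zero (hγ' j) (by
      rw [trace_mul_of_orthonormal htop.left_orthonormal htop.left_hermitian, if_neg hij])
  have hr : ∀ i j, i ≠ j → δ' i * δ' j = 0 := fun i j hij =>
    (hδ' i).mul_eq_zero_of_trace_mul_eq_zero (hδ' j) (by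
      rw [trace_mul_of_orthonormal htop.right_orthonormal htop.right_hermitian, if_neg hij])
  obtain ⟨V, hV⟩ := exists_isProjectionSystem htop.left_hermitian hl
  obtain ⟨W, hW⟩ := exists_isProjectionSystem htop.right_hermitian hr
  exact ⟨s, _, t, μ, ν, _, _, γ', δ', V, W, ⟨hs, hν, h, htop, hγ', hδ', hV, hW⟩, fun _ => rfl⟩

theorem IsSPC.exists_splitDecomposition {A : BiMat k k} (hA : IsSPC A) (hA0 : A ≠ 0) :
    ∃ (s : ℕ) (T : Fin (s + 1) → BiMat k k), IsSPCSplitDecomposition s A T := by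
  obtain ⟨n, c, γ, h⟩ := hA.2
  obtain ⟨s, t, μ, ν, f, hs, hν, h⟩ := h.exists_top hA0
  have hμ : 0 < μ := h.pos (Sum.inl ⟨0, hs⟩)
  -- Both members of a top pair have the same coefficients, here on the same matrices γ.
  have hsymm : ∀ {X Y}, IsSingularPair A μ X Y → Y = X := fun hXY =>
    (h.eq_sum_of_isSingularPair hμ hν hXY).2.trans
      (h.eq_sum_of_isSingularPair hμ hν hXY).1.symm
  obtain ⟨γ', δ', htop, hγ', -, hpair⟩ := h.exists_posSemidef_top hA.1 hμ hν (by
    intro X Y hX hY hXY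
    obtain rfl := hsymm hXY
    obtain ⟨V, Z, hV1, hV2, hV3, hV4⟩ := hX.1.exists_support_projection
    exact ⟨V, Z, V, ⟨hV1, hV2⟩, ⟨hV1, hV2⟩, hV3, hV4, hXY.eq_compress_add_compress hA.1 hX hY
      ⟨hV1, hV2⟩ ⟨hV1, hV2⟩ hV3 hV4 hV3 hV4 fun h1 _ => hA.off_diagonal_eq_zero ⟨hV1, hV2⟩
        (IsHermitianProjection.one_sub ⟨hV1, hV2⟩) h1⟩)
  obtain rfl : δ' = γ' := funext fun i => hsymm (hpair i)
  have hl : ∀ i j, i ≠ j → δ' i * δ' j = 0 := fun i j hij =>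
    (hγ' i).mul_eq_zero_of_trace_mul_eq_zero (hγ' j) (by
      rw [trace_mul_of_orthonormal htop.left_orthonormal htop.left_hermitian, if_neg hij])
  obtain ⟨V, hV⟩ := exists_isProjectionSystem htop.left_hermitian hl
  exact ⟨s, _, t, μ, ν, _, δ', V, ⟨hs, hν, h, htop, hγ', hγ', hV, hV⟩, fun _ => rfl⟩

end Existence

/-! ### One splitting step and the recursive reduction -/

section Reduction

variable {k m : ℕ}

/-- Compression destroys orthonormality of the γᵢ but keeps the shape ∑ cᵢ Xᵢ ⊗ Xᵢ with cᵢ > 0,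
which can be diagonalised afresh. -/
theorem IsSPC.compress {A : BiMat k k} (hA : IsSPC A) {V : Mat k} (hV : V.IsHermitian) :
    IsSPC (compress V V A) := by
  obtain ⟨hpos, n, c, γ, h⟩ := hA
  refine ⟨compress_posSemidef hpos hV hV, ?_⟩
  obtain ⟨κ, _, _, e, u, hu⟩ := exists_symmetric_schmidtDecomposition (fun i => (h.pos i).le)
    (X := fun i => V * γ i * V) (fun i => by
      have := isHermitian_mul_mul_conjTranspose V (h.left_hermitian i)
      rwa [hV.eq] at this)
  have hsum : _root_.compress V V A = ∑ i, (c i : ℂ) • ((V * γ i * V) ⊗ₖ (V * γ i * V)) := by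
    rw [h.eq_sum, compress_sum]
    simp only [compress_smul, compress_kronecker]
  rw [hsum]
  exact ⟨_, _, _, hu.reindex (Fintype.equivFin κ).symm⟩

theorem isWeakIrreducible_zero : IsWeakIrreducible (0 : BiMat k m) :=
  ⟨PosSemidef.zero, fun _ _ _ _ _ _ _ _ _ _ _ _ _ => Or.inl (by simp [compress])⟩

/-- The effect of one split decomposition. -/
structure IsGoodStep (P : BiMat k m → Prop) (s : ℕ) (A : BiMat k m)
    (T : Fin (s + 1) → BiMat k m) : Prop where
  eq_sum : A = ∑ i, T i
  mem : ∀ i, P (T i)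
  separable_iff : IsSeparableMatrix A ↔ ∀ i, IsSeparableMatrix (T i)
  tensorRank_lt : ¬ IsWeakIrreducible A → ∀ i, tensorRank (T i) < tensorRank A

theorem IsPPTSplitDecomposition.isGoodStep {A : BiMat k m} (hA : IsPPT A) {s : ℕ}
    {T : Fin (s + 1) → BiMat k m} (h : IsPPTSplitDecomposition s A T) : IsGoodStep IsPPT s A T := by
  obtain ⟨t, μ, ν, γ, δ, γ', δ', V, W, h, hT⟩ := h
  obtain rfl : T = fun i => compress (V i) (W i) A := funext hT
  have hV := (h.left_projections.resolution h.schmidt_top.left_hermitian h.left_mul_eq_zero).1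
  have hW := (h.right_projections.resolution h.schmidt_top.right_hermitian h.right_mul_eq_zero).1
  have hoff : ∀ i j, i ≠ j → (V i ⊗ₖ W i) * A * (V j ⊗ₖ W j) = 0 := fun i j hij =>
    hA.off_diagonal_eq_zero (hV i) (hW j) (h.mixed hA.1 i j hij)
  have hB := h.isBlockDecomposition hA.1 hoff
  exact ⟨hB.eq_sum hA.1.1, fun i => hA.compress (hV i).1 (hW i).1,
    hB.isSeparableMatrix_iff hA.1.1, h.tensorRank_lt hA.1 hoff⟩

theorem IsSPCSplitDecomposition.isGoodStep {A : BiMat k k} (hA : IsSPC A) {s : ℕ}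
    {T : Fin (s + 1) → BiMat k k} (h : IsSPCSplitDecomposition s A T) : IsGoodStep IsSPC s A T := by
  obtain ⟨t, μ, ν, γ, γ', V, h, hT⟩ := h
  obtain rfl : T = fun i => compress (V i) (V i) A := funext hT
  have hV := (h.left_projections.resolution h.schmidt_top.left_hermitian h.left_mul_eq_zero).1
  have hoff : ∀ i j, i ≠ j → (V i ⊗ₖ V i) * A * (V j ⊗ₖ V j) = 0 := fun i j hij =>
    hA.off_diagonal_eq_zero (hV i) (hV j) (h.mixed hA.1 i j hij)
  have hB := h.isBlockDecomposition hA.1 hoff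
  exact ⟨hB.eq_sum hA.1.1, fun i => hA.compress (hV i).1,
    hB.isSeparableMatrix_iff hA.1.1, h.tensorRank_lt hA.1 hoff⟩

variable {P : BiMat k m → Prop}
  {step : (s : ℕ) → BiMat k m → (Fin (s + 1) → BiMat k m) → Prop}

theorem SplitReduction.exists_of_isGoodStep
    (hex : ∀ A, P A → A ≠ 0 → ∃ (s : ℕ) (T : Fin (s + 1) → BiMat k m), step s A T)
    (hgood : ∀ A, P A → ∀ s T, step s A T → IsGoodStep P s A T) (A : BiMat k m) (hA : P A) :
    ∃ L, SplitReduction step A L := by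
  induction hr : tensorRank A using Nat.strong_induction_on generalizing A with
  | _ r ih =>
  subst hr
  by_cases hw : IsWeakIrreducible A
  · exact ⟨[A], .keep A hw⟩
  -- A split decomposition is available because 0 is weak irreducible, so `A` is nonzero.
  · obtain ⟨s, T, hT⟩ := hex A hA fun h => hw (h ▸ isWeakIrreducible_zero)
    have hg := hgood A hA s T hT
    choose L hL using fun i => ih _ (hg.tensorRank_lt hw i) (T i) (hg.mem i) rfl
    exact ⟨_, .split A s T L hw hT hL⟩

theorem SplitReduction.of_isGoodStep
    (hgood : ∀ A, P A → ∀ s T, step s A T → IsGoodStep P s A T) {A : BiMat k m}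
    {L : List (BiMat k m)} (h : SplitReduction step A L) (hA : P A) :
    (∀ B ∈ L, P B ∧ IsWeakIrreducible B) ∧
      (IsSeparableMatrix A ↔ ∀ B ∈ L, IsSeparableMatrix B) := by
  induction h with
  | keep A hw => simp [hA, hw]
  | split A s T L hw hT _ ih =>
    have hg := hgood A hA s T hT
    refine ⟨fun B hB => ?_, ?_⟩
    · obtain ⟨l, hl, hBl⟩ := List.mem_flatten.mp hB
      obtain ⟨i, rfl⟩ := (List.mem_ofFn' _ _).mp hl
      exact (ih i (hg.mem i)).1 B hBl
    · rw [hg.separable_iff]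
      constructor
      · intro h B hB
        obtain ⟨l, hl, hBl⟩ := List.mem_flatten.mp hB
        obtain ⟨i, rfl⟩ := (List.mem_ofFn' _ _).mp hl
        exact (ih i (hg.mem i)).2.mp (h i) B hBl
      · exact fun h i => (ih i (hg.mem i)).2.mpr fun B hB =>
          h B (List.mem_flatten.mpr ⟨L i, (List.mem_ofFn' _ _).mpr ⟨i, rfl⟩, hB⟩)

theorem splitReduction_properties
    (hex : ∀ A, P A → A ≠ 0 → ∃ (s : ℕ) (T : Fin (s + 1) → BiMat k m), step s A T)
    (hgood : ∀ A, P A → ∀ s T, step s A T → IsGoodStep P s A T) (A : BiMat k m) (hA : P A) :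
    (A ≠ 0 → ∃ (s : ℕ) (T : Fin (s + 1) → BiMat k m), step s A T) ∧
      (∀ (s : ℕ) (T : Fin (s + 1) → BiMat k m), step s A T →
        A = ∑ i, T i ∧
        (∀ i, P (T i)) ∧
        (IsSeparableMatrix A ↔ ∀ i, IsSeparableMatrix (T i)) ∧
        (¬ IsWeakIrreducible A → ∀ i, tensorRank (T i) < tensorRank A)) ∧
      (∃ L : List (BiMat k m), SplitReduction step A L) ∧
      (∀ L : List (BiMat k m), SplitReduction step A L →
        (∀ B ∈ L, P B ∧ IsWeakIrreducible B) ∧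
        (∀ Q : BiMat k m → Prop,
          (∀ B : BiMat k m, P B → IsWeakIrreducible B → (Q B ↔ IsSeparableMatrix B)) →
          (IsSeparableMatrix A ↔ ∀ B ∈ L, Q B))) := by
  refine ⟨hex A hA, fun s T hT => ?_, SplitReduction.exists_of_isGoodStep hex hgood A hA,
    fun L hL => ?_⟩
  · obtain ⟨h1, h2, h3, h4⟩ := hgood A hA s T hT
    exact ⟨h1, h2, h3, h4⟩
  · obtain ⟨h1, h2⟩ := hL.of_isGoodStep hgood hA
    refine ⟨h1, fun Q hQ => h2.trans (forall₂_congr fun B hB => ?_)⟩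
    exact (hQ B (h1 B hB).1 (h1 B hB).2).symm

end Reduction

theorem mainTheorem6 :
    (∀ (k : ℕ) (A : BiMat k k), IsSPC A →
      (A ≠ 0 → ∃ (s : ℕ) (T : Fin (s + 1) → BiMat k k), IsSPCSplitDecomposition s A T) ∧
      (∀ (s : ℕ) (T : Fin (s + 1) → BiMat k k), IsSPCSplitDecomposition s A T →
        A = ∑ i, T i ∧
        (∀ i, IsSPC (T i)) ∧
        (IsSeparableMatrix A ↔ ∀ i, IsSeparableMatrix (T i)) ∧
        (¬ IsWeakIrreducible A → ∀ i, tensorRank (T i) < tensorRank A)) ∧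
      (∃ L : List (BiMat k k), SplitReduction IsSPCSplitDecomposition A L) ∧
      (∀ L : List (BiMat k k), SplitReduction IsSPCSplitDecomposition A L →
        (∀ B ∈ L, IsSPC B ∧ IsWeakIrreducible B) ∧
        (∀ Q : BiMat k k → Prop,
          (∀ B : BiMat k k, IsSPC B → IsWeakIrreducible B → (Q B ↔ IsSeparableMatrix B)) →
          (IsSeparableMatrix A ↔ ∀ B ∈ L, Q B)))) ∧
    (∀ (k m : ℕ) (A : BiMat k m), IsPPT A →
      (A ≠ 0 → ∃ (s : ℕ) (T : Fin (s + 1) → BiMat k m), IsPPTSplitDecomposition s A T) ∧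
      (∀ (s : ℕ) (T : Fin (s + 1) → BiMat k m), IsPPTSplitDecomposition s A T →
        A = ∑ i, T i ∧
        (∀ i, IsPPT (T i)) ∧
        (IsSeparableMatrix A ↔ ∀ i, IsSeparableMatrix (T i)) ∧
        (¬ IsWeakIrreducible A → ∀ i, tensorRank (T i) < tensorRank A)) ∧
      (∃ L : List (BiMat k m), SplitReduction IsPPTSplitDecomposition A L) ∧
      (∀ L : List (BiMat k m), SplitReduction IsPPTSplitDecomposition A L →
        (∀ B ∈ L, IsPPT B ∧ IsWeakIrreducible B) ∧
        (∀ Q : BiMat k m → Prop,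
          (∀ B : BiMat k m, IsPPT B → IsWeakIrreducible B → (Q B ↔ IsSeparableMatrix B)) →
          (IsSeparableMatrix A ↔ ∀ B ∈ L, Q B)))) := by
  exact ⟨fun k => splitReduction_properties (fun _ hA => hA.exists_splitDecomposition)
      fun _ hA _ _ hT => hT.isGoodStep hA,
    fun k m => splitReduction_properties (fun _ hA => hA.exists_splitDecomposition)
      fun _ hA _ _ hT => hT.isGoodStep hA⟩
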